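/- **Theorem 1.3 (Linear stabilization).** Let $L>0$, $\nu>0$, $\alpha\in\mathbb R$, $\gamma\ge 0$, $\mu>0$. For $j\ge1$ put $\lambda_j=\left(\frac{2j-1}{2}\right)^2\frac{\pi^2}{L^2}$, $e_j(x)=\sqrt{2/L}\,\sin\frac{(2j-1)\pi x}{2L}$, and for $N\ge 1$ let $P_N\varphi=\sum_{j=1}^N (e_j,\varphi)_{L^2(0,L)}\,e_j$. Let $k$ be a classical solution ($C^2$ up to the boundary) on the triangle $0\le y\le x\le L$ of $$(\nu+i\alpha)(k_{xx}-k_{yy})+\mu k=0,\qquad k(x,0)=0,\qquad k(x,x)=-\frac{\mu x}{2(\nu+i\alpha)} .$$ Let $(T_Nw)(x)=w(x)+\int_0^x k(x,y)(P_Nw)(y)\,dy$ on $L^2(0,L)$. The pair $(\mu,N)$, with $\mu>0$ and $N\ge1$, is called *admissible* if $T_N$ is invertible with a bounded inverse; in that case put $\Gamma_N=I-P_N(I-T_N^{-1})$, and for $v$ in the range of $P_N$ $$b(v)=\int_0^L k_x(L,y)\,(\Gamma_N v)(y)\,dy-\frac{\mu L}{2(\nu+i\alpha)}(\Gamma_N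 v)(L).$$ Consider the closed-loop problem $$u_t-(\nu+i\alpha)u_{xx}-\gamma u=0,\quad u(0,t)=0,\quad u_x(L,t)=b(P_Nu(\cdot,t)),\quad u(x,0)=u_0(x),\qquad x\in(0,L),\ t>0, \tag{$*$}$$ with $u_0\in H^1(0,L)$, $u_0(0)=0$. A weak solution on $[0,\tau]$ is a $u\in C([0,\tau];H^1(0,L))$ with $u(\cdot,0)=u_0$ and $u(0,t)=0$ for all $t\in[0,\tau]$ such that, for every smooth $\varphi$ with $\varphi(0)=0$ and every $t\in[0,\tau]$, $$\int_0^L u(x,t)\varphi(x)\,dx=\int_0^L u_0\varphi\,dx+\int_0^t\Big[(\nu+i\alpha)\Big(b(P_Nu(\cdot,s))\varphi(L)-\int_0^L u_x(x,s)\varphi'(x)\,dx\Big)+\gamma\int_0^L u(x,s)\varphi(x)\,dx\Big]ds .$$ (i) (Rapid stabilization) Suppose $\mu>\gamma-\nu\lambda_1$, $$N>\max\left\{\frac{\mu}{4\nu\lambda_1}-\frac12,\ \frac{\mu}{2(\mu+\nu\lambda_1-\gamma)}-\frac12\right\},$$ and $(\mu,N)$ is admissible. Then for every $u_0\in H^1(0,L)$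 with $u_0(0)=0$, problem $(*)$ has a global weak solution, which is unique on every interval $[0,\tau]$; the zero equilibrium is globally exponentially stable in $H^1(0,L)$; and there is a constant $c_k>0$, independent of $u_0$, such that for all $t\ge0$ $$\|u(t)\|_{H^1(0,L)}\le c_k e^{-\eta_1t}\|u_0\|_{H^1(0,L)},\qquad \eta_1=\nu\lambda_1-\gamma+\mu\left(1-\frac1{2N+1}\right).$$ (ii) (Minimal Fourier mode count) Let $M\ge1$ with $\lambda_M\le\frac{\gamma}{\nu}<\lambda_{M+1}$. Suppose $$2(\gamma-\nu\lambda_1)\left(1-\frac1{2M+1}\right)^{-1}<\mu<2\nu\lambda_{M+1}$$ and $(\mu,M)$ is admissible. Then, with $N=M$ in $(*)$, the same well-posedness and global exponential stability in $H^1(0,L)$ hold, and there is a constant $c_k>0$, independent of $u_0$, such that for all $t\ge0$ $$\|u(t)\|_{H^1(0,L)}\le c_k e^{-\eta_2t}\|u_0\|_{H^1(0,L)},\qquad \eta_2=\nu\lambda_1-\gamma+\frac{\mu}{2}\left(1-\frac1{(2M+1)^2}\right).$$ -/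

import Mathlib

open MeasureTheory Set

open scoped ContDiff

noncomputable section

namespace CGL

/-- The space `L²(0, L)` of complex-valued functions. -/
abbrev L2 (L : ℝ) : Type := Lp ℂ 2 (volume.restrict (Ioo 0 L))

/-- `g` is the weak derivative of `f` on `(0, L)`, tested against `C_c^∞(0, L)`. -/
def IsWeakDeriv (L : ℝ) (f g : L2 L) : Prop :=
  ∀ φ : ℝ → ℂ, ContDiff ℝ ∞ φ → HasCompactSupport φ → tsupport φ ⊆ Ioo 0 L →
    ∫ x in Ioo 0 L, f x * deriv φ x = - ∫ x in Ioo 0 L, g x * φ x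

/-- The product of an `L²(0, L)` function and a continuous function is integrable on `(0, L)`. -/
theorem integrable_mul_cont (L : ℝ) (f : L2 L) {ψ : ℝ → ℂ} (hψ : Continuous ψ) :
    Integrable (fun x => f x * ψ x) (volume.restrict (Ioo 0 L)) := by
  obtain ⟨C, hC⟩ := isCompact_Icc.exists_bound_of_continuousOn (s := Icc (0 : ℝ) L) hψ.continuousOn
  have h1 : Integrable (fun x => f x) (volume.restrict (Ioo 0 L)) :=
    (Lp.memLp f).integrable (by norm_num)
  refine Integrable.mul_bdd (c := C) h1 hψ.aestronglyMeasurable ?_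
  filter_upwards [ae_restrict_mem measurableSet_Ioo] with x hx
  exact hC x (Ioo_subset_Icc_self hx)

/-- The Sobolev space `H¹(0, L)`: pairs `(f, f')` in `L² × L²` with `f'` the weak derivative
of `f`, with the norm `(‖f‖² + ‖f'‖²)^{1/2}`. -/
def H1 (L : ℝ) : Submodule ℂ (WithLp 2 (L2 L × L2 L)) where
  carrier := {p | IsWeakDeriv L p.fst p.snd}
  zero_mem' := by
    intro φ _ _ _
    have h : ∀ᵐ x ∂(volume.restrict (Ioo 0 L)), (0 : L2 L) x = 0 := Lp.coeFn_zero _ _ _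
    have h1 : ∀ ψ : ℝ → ℂ, ∫ x in Ioo 0 L, (0 : L2 L) x * ψ x = 0 := by
      intro ψ
      rw [integral_congr_ae (g := fun _ => (0 : ℂ)) (by
        filter_upwards [h] with x hx
        rw [hx, zero_mul])]
      simp
    change ∫ x in Ioo 0 L, (0 : L2 L) x * deriv φ x = - ∫ x in Ioo 0 L, (0 : L2 L) x * φ x
    rw [h1, h1, neg_zero]
  add_mem' := by
    intro p q hp hq φ h1 h2 h3
    have key : ∀ (f g : L2 L) (ψ : ℝ → ℂ), Continuous ψ →
        ∫ x in Ioo 0 L, (f + g) x * ψ x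
          = (∫ x in Ioo 0 L, f x * ψ x) + ∫ x in Ioo 0 L, g x * ψ x := by
      intro f g ψ hψ
      rw [← integral_add (integrable_mul_cont L f hψ) (integrable_mul_cont L g hψ)]
      refine integral_congr_ae ?_
      filter_upwards [Lp.coeFn_add f g] with x hx
      rw [hx, Pi.add_apply, add_mul]
    have hd : Continuous (deriv φ) := h1.continuous_deriv (by simp)
    change ∫ x in Ioo 0 L, (p.fst + q.fst) x * deriv φ x
      = - ∫ x in Ioo 0 L, (p.snd + q.snd) x * φ x
    rw [key _ _ _ hd, key _ _ _ h1.continuous, hp φ h1 h2 h3, hq φ h1 h2 h3, neg_add]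
  smul_mem' := by
    intro c p hp φ h1 h2 h3
    have key : ∀ (f : L2 L) (ψ : ℝ → ℂ),
        ∫ x in Ioo 0 L, (c • f) x * ψ x = c * ∫ x in Ioo 0 L, f x * ψ x := by
      intro f ψ
      rw [← integral_const_mul]
      refine integral_congr_ae ?_
      filter_upwards [Lp.coeFn_smul c f] with x hx
      rw [hx, Pi.smul_apply, smul_eq_mul, mul_assoc]
    change ∫ x in Ioo 0 L, (c • p.fst) x * deriv φ x = - ∫ x in Ioo 0 L, (c • p.snd) x * φ x
    rw [key, key, hp φ h1 h2 h3, mul_neg]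

/-- The underlying `L²` function `u` of an element of `H¹(0, L)`. -/
def fn {L : ℝ} (u : H1 L) : L2 L := (u : WithLp 2 (L2 L × L2 L)).fst

/-- The weak derivative `u_x` of an element of `H¹(0, L)`. -/
def dx {L : ℝ} (u : H1 L) : L2 L := (u : WithLp 2 (L2 L × L2 L)).snd

/-- `u(0) = 0` for `u ∈ H¹(0, L)`: the continuous representative of `u` on `[0, L]` vanishes
at `0`. -/
def VanishesAtZero {L : ℝ} (u : H1 L) : Prop :=
  ∃ f : ℝ → ℂ, ContinuousOn f (Icc 0 L) ∧ fn u =ᵐ[volume.restrict (Ioo 0 L)] f ∧ f 0 = 0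

/-- The eigenvalues `λ_j = ((2j-1)/2)² π²/L²` (`j ≥ 1`) of the Dirichlet-Neumann Laplacian. -/
def eigval (L : ℝ) (j : ℕ) : ℝ := ((2 * (j : ℝ) - 1) / 2) ^ 2 * (Real.pi ^ 2 / L ^ 2)

/-- The eigenfunctions `e_j(x) = √(2/L) sin((2j-1)πx/(2L))` (`j ≥ 1`). -/
def eigfun (L : ℝ) (j : ℕ) (x : ℝ) : ℂ :=
  ((Real.sqrt (2 / L) * Real.sin ((2 * (j : ℝ) - 1) * Real.pi * x / (2 * L)) : ℝ) : ℂ)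

theorem eigfun_memLp (L : ℝ) (j : ℕ) : MemLp (eigfun L j) 2 (volume.restrict (Ioo 0 L)) := by
  have hc : Continuous (eigfun L j) := by
    unfold eigfun
    fun_prop
  refine MemLp.of_bound hc.aestronglyMeasurable (Real.sqrt (2 / L)) (Filter.Eventually.of_forall ?_)
  intro x
  unfold eigfun
  rw [Complex.norm_real, Real.norm_eq_abs, abs_mul, abs_of_nonneg (Real.sqrt_nonneg _)]
  exact mul_le_of_le_one_right (Real.sqrt_nonneg _) (Real.abs_sin_le_one _)

/-- `e_j` as an element of `L²(0, L)`. -/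
def eigL2 (L : ℝ) (j : ℕ) : L2 L := (eigfun_memLp L j).toLp (eigfun L j)

/-- The projection `P_N φ = ∑_{j=1}^N (e_j, φ)₂ e_j` as a bounded operator on `L²(0, L)`. -/
def proj (L : ℝ) (N : ℕ) : L2 L →L[ℂ] L2 L :=
  ∑ j ∈ Finset.Icc 1 N, (innerSL ℂ (eigL2 L j)).smulRight (eigL2 L j)

/-- The smooth function `x ↦ (P_N φ)(x) = ∑_{j=1}^N (e_j, φ)₂ e_j(x)`. -/
def projFun (L : ℝ) (N : ℕ) (φ : L2 L) (x : ℝ) : ℂ :=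
  ∑ j ∈ Finset.Icc 1 N, inner ℂ (eigL2 L j) φ * eigfun L j x

/-- The closed triangle `{0 ≤ x ≤ L, 0 ≤ y ≤ x}`. -/
def triangle (L : ℝ) : Set (ℝ × ℝ) := {p | 0 ≤ p.2 ∧ p.2 ≤ p.1 ∧ p.1 ≤ L}

/-- `k` is a classical (`C²` up to the boundary) solution on the triangle of
`(ν + iα)(k_xx - k_yy) + μ k = 0`, `k(x,0) = 0`, `k(x,x) = -μ x / (2(ν + iα))`.
Only the values of `k` on the closed triangle matter. -/
structure IsKernel (L ν α μ : ℝ) (k : ℝ → ℝ → ℂ) : Prop where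
  contDiffOn : ContDiffOn ℝ 2 (fun p : ℝ × ℝ => k p.1 p.2) (triangle L)
  pde : ∀ x y : ℝ, 0 < y → y < x → x < L →
    ((ν : ℂ) + Complex.I * α) *
        (iteratedDeriv 2 (fun s => k s y) x - iteratedDeriv 2 (fun s => k x s) y)
      + (μ : ℂ) * k x y = 0
  bottom : ∀ x ∈ Icc 0 L, k x 0 = 0
  diagonal : ∀ x ∈ Icc 0 L, k x x = -((μ : ℂ) * x) / (2 * ((ν : ℂ) + Complex.I * α))

/-- `(μ, N)` is an admissible decay rate-mode pair: the operator
`(T_N w)(x) = w(x) + ∫₀ˣ k(x,y) (P_N w)(y) dy` on `L²(0, L)` is invertible with a bounded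
inverse. Here `T` is the operator `T_N` as a bounded isomorphism (the formula determines it). -/
structure IsAdmissible (L : ℝ) (k : ℝ → ℝ → ℂ) (μ : ℝ) (N : ℕ) (T : L2 L ≃L[ℂ] L2 L) : Prop where
  rate_pos : 0 < μ
  mode_pos : 1 ≤ N
  apply_ae : ∀ w : L2 L, T w =ᵐ[volume.restrict (Ioo 0 L)]
    fun x => w x + ∫ y in (0 : ℝ)..x, k x y * projFun L N w y

/-- The operator `Υ_N = I - T_N⁻¹`. -/
def upsilon {L : ℝ} (T : L2 L ≃L[ℂ] L2 L) : L2 L →L[ℂ] L2 L :=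
  ContinuousLinearMap.id ℂ (L2 L) - (T.symm : L2 L →L[ℂ] L2 L)

/-- The operator `Γ_N = I - P_N Υ_N`. -/
def gammaOp {L : ℝ} (N : ℕ) (T : L2 L ≃L[ℂ] L2 L) : L2 L →L[ℂ] L2 L :=
  ContinuousLinearMap.id ℂ (L2 L) - (proj L N).comp (upsilon T)

/-- The feedback law, a function of `v = P_N u`,
`b(v) = ∫₀ᴸ k_x(L,y) (Γ_N v)(y) dy - μL/(2(ν+iα)) (Γ_N v)(L)`.
For `v` in the range of `P_N` also `Γ_N v` lies in that range, so its smooth representative is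
`projFun L N (Γ_N v)`. The partial derivative `k_x(L,y)` is taken from within the triangle. -/
def feedback (L ν α μ : ℝ) (k : ℝ → ℝ → ℂ) (N : ℕ) (T : L2 L ≃L[ℂ] L2 L) (v : L2 L) : ℂ :=
  (∫ y in (0 : ℝ)..L,
      derivWithin (fun x => k x y) (Icc y L) L * projFun L N (gammaOp N T v) y)
    - (μ : ℂ) * L / (2 * ((ν : ℂ) + Complex.I * α)) * projFun L N (gammaOp N T v) L

/-- `u ∈ C([0, τ]; H¹(0, L))` is a weak solution on the time interval `[0, τ]` of
`u_t - (ν + iα) u_xx - γ u = 0`, `u(0,t) = 0`, `u_x(L,t) = b(P_N u(t))`, `u(x,0) = u₀(x)`: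
the equation is multiplied by a smooth `φ` with `φ(0) = 0`, integrated by parts over `(0, L)`
using the Neumann condition, and integrated in time. -/
structure IsWeakSolution (L ν α γ μ : ℝ) (k : ℝ → ℝ → ℂ) (N : ℕ) (T : L2 L ≃L[ℂ] L2 L)
    (τ : ℝ) (u₀ : H1 L) (u : ℝ → H1 L) : Prop where
  continuousOn : ContinuousOn u (Icc 0 τ)
  initial : u 0 = u₀
  dirichlet : ∀ t ∈ Icc 0 τ, VanishesAtZero (u t)
  weak : ∀ φ : ℝ → ℂ, ContDiff ℝ ∞ φ → φ 0 = 0 → ∀ t ∈ Icc 0 τ,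
    ∫ x in Ioo 0 L, fn (u t) x * φ x =
      (∫ x in Ioo 0 L, fn u₀ x * φ x) +
      ∫ s in (0 : ℝ)..t,
        (((ν : ℂ) + Complex.I * α) *
            (feedback L ν α μ k N T (proj L N (fn (u s))) * φ L
              - ∫ x in Ioo 0 L, dx (u s) x * deriv φ x)
          + (γ : ℂ) * ∫ x in Ioo 0 L, fn (u s) x * φ x)

/-- Weak solution for all times `t ≥ 0`. -/
def IsGlobalWeakSolution (L ν α γ μ : ℝ) (k : ℝ → ℝ → ℂ) (N : ℕ) (T : L2 L ≃L[ℂ] L2 L)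
    (u₀ : H1 L) (u : ℝ → H1 L) : Prop :=
  ∀ τ : ℝ, 0 < τ → IsWeakSolution L ν α γ μ k N T τ u₀ u

/-- Each compatible initial datum `u₀ ∈ H¹(0, L)`, `u₀(0) = 0`, has a global weak solution, and
every weak solution on a bounded time interval coincides with it there. -/
def IsWellPosed (L ν α γ μ : ℝ) (k : ℝ → ℝ → ℂ) (N : ℕ) (T : L2 L ≃L[ℂ] L2 L) : Prop :=
  ∀ u₀ : H1 L, VanishesAtZero u₀ →
    ∃ u : ℝ → H1 L, IsGlobalWeakSolution L ν α γ μ k N T u₀ u ∧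
      ∀ (τ : ℝ) (v : ℝ → H1 L), 0 < τ → IsWeakSolution L ν α γ μ k N T τ u₀ v →
        ∀ t ∈ Icc 0 τ, v t = u t

/-- The decay estimate `‖u(t)‖_{H¹} ≤ c e^{-ηt} ‖u₀‖_{H¹}` for all weak solutions, with a
constant `c > 0` that does not depend on the initial datum. -/
def DecaysAtRate (L ν α γ μ : ℝ) (k : ℝ → ℝ → ℂ) (N : ℕ) (T : L2 L ≃L[ℂ] L2 L) (η : ℝ) : Prop :=
  ∃ c : ℝ, 0 < c ∧ ∀ (u₀ : H1 L) (u : ℝ → H1 L), VanishesAtZero u₀ →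
    IsGlobalWeakSolution L ν α γ μ k N T u₀ u →
      ∀ t : ℝ, 0 ≤ t → ‖u t‖ ≤ c * Real.exp (-η * t) * ‖u₀‖

/-- The zero equilibrium is globally exponentially stable in `H¹(0, L)`. -/
def IsGloballyExpStable (L ν α γ μ : ℝ) (k : ℝ → ℝ → ℂ) (N : ℕ) (T : L2 L ≃L[ℂ] L2 L) : Prop :=
  ∃ η : ℝ, 0 < η ∧ DecaysAtRate L ν α γ μ k N T η

end CGL

end

/-! Put a = ν + iα, let V be integration from 0, and let κ_j(x) = ∫₀ˣ k(x,y) e_j(y) dy.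
Differentiating κ_j twice, using the kernel equation, moving two y-derivatives onto e_j and
inserting the condition on the diagonal gives a κ_j'' = -μ e_j - (a λ_j + μ) κ_j
(`kerEigDeriv_eq_integral`). Since T_N w = w + ∑_{j≤N} (e_j, w) κ_j, the functions T_N e_j, namely
e_j + κ_j for j ≤ N and e_j for j > N, solve a f'' + γ f = σ_j f with σ_j = γ - a λ_j - μ·1_{j≤N}.

They also satisfy the boundary condition. T_N⁻¹ preserves the kernel of P_N, so Γ_N P_N u = P_N
T_N⁻¹ u and b(P_N u) = ∑_{j≤N} κ_j'(L) (e_j, T_N⁻¹ u) (`IsAdmissible.feedback_eq`). At u = T_N e_j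
this is exactly the derivative of T_N e_j at L, because e_j'(L) = 0. Hence T_N conjugates the closed
loop to the target system w_t = a w_xx + γ w - μ P_N w with w(0) = w_x(L) = 0, which is diagonal in
the e_j.

To work in H¹, functions vanishing at 0 are identified with their derivatives in L². The e_j then
become multiples of the cosines, a Hilbert basis of L² (`cosL2_complete`), and T_N becomes R =
`derivTransform`, with V R = T_N V. The solution is V R S(t) R⁻¹ u₀', with S the diagonal semigroup
of the σ_j. The weak form reduces to a scalar identity on each basis vector
(`IsAdmissible.exists_functionals`), and the decay of S passes to the H¹ norm.

For uniqueness, the feedback sees only the first N modes, so for J ≥ N the first J modes of a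
difference of two solutions obey a closed linear ODE with zero initial value. The decay rate then
needs only Re σ_j ≤ -η. Since λ_j increases, this has to be checked at j = 1 and j = N + 1 alone,
where λ_{N+1} = (2N+1)² λ_1. -/

noncomputable section

namespace CGL

/-! ### Diagonal semigroups in a Hilbert basis -/

section DiagonalSemigroup

variable {E : Type*} [NormedAddCommGroup E] [InnerProductSpace ℂ E]

/-- The diagonal operator with multipliers `m` in the Hilbert basis `b`. -/
def diagOp (b : HilbertBasis ℕ ℂ E) (m : ℕ → ℂ) (g : E) : E :=
  ∑' j, (m j * inner ℂ (b j) g) • b j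

theorem summable_norm_inner_sq (b : HilbertBasis ℕ ℂ E) (g : E) :
    Summable fun j => ‖inner ℂ (b j) g‖ ^ 2 :=
  b.orthonormal.inner_products_summable g

theorem hasSum_norm_inner_sq (b : HilbertBasis ℕ ℂ E) (g : E) :
    HasSum (fun j => ‖inner ℂ (b j) g‖ ^ 2) (‖g‖ ^ 2) := by
  have h := (b.hasSum_inner_mul_inner g g).mapL Complex.reCLM
  have h2 : ∀ x : E, Complex.reCLM (inner ℂ x x) = ‖x‖ ^ 2 := fun x => by
    simpa using inner_self_eq_norm_sq (𝕜 := ℂ) x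
  rw [h2] at h
  convert h using 2 with j
  rw [← inner_conj_symm g, Complex.reCLM_apply, Complex.conj_mul', ← Complex.ofReal_pow,
    Complex.ofReal_re]

theorem hasSum_diagOp (b : HilbertBasis ℕ ℂ E) {m : ℕ → ℂ} {C : ℝ} (hm : ∀ j, ‖m j‖ ≤ C) (g : E) :
    HasSum (fun j => (m j * inner ℂ (b j) g) • b j) (diagOp b m g) := by
  have hmem : Memℓp (fun j => m j * inner ℂ (b j) g : ℕ → ℂ) 2 := by
    refine memℓp_gen (((summable_norm_inner_sq b g).mul_left (C ^ 2)).of_nonneg_of_le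
      (fun j => by positivity) fun j => ?_)
    simp only [ENNReal.toReal_ofNat, Real.rpow_ofNat, norm_mul, mul_pow]
    gcongr
    exact hm j
  exact (b.hasSum_repr_symm ⟨_, hmem⟩).summable.hasSum

theorem inner_diagOp (b : HilbertBasis ℕ ℂ E) {m : ℕ → ℂ} {C : ℝ} (hm : ∀ j, ‖m j‖ ≤ C) (g : E)
    (i : ℕ) : inner ℂ (b i) (diagOp b m g) = m i * inner ℂ (b i) g := by
  have h := (hasSum_diagOp b hm g).mapL (innerSL ℂ (b i))
  refine h.unique ?_
  have key : ∀ j, innerSL ℂ (b i) ((m j * inner ℂ (b j) g) • b j)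
      = if j = i then m i * inner ℂ (b i) g else 0 := fun j => ?_
  · simp only [key]
    exact hasSum_ite_eq i _
  simp only [innerSL_apply_apply, inner_smul_right, orthonormal_iff_ite.1 b.orthonormal i j]
  by_cases hij : j = i
  · simp [hij]
  · simp [hij, Ne.symm hij]

theorem norm_diagOp_le (b : HilbertBasis ℕ ℂ E) {m : ℕ → ℂ} {C : ℝ} (hm : ∀ j, ‖m j‖ ≤ C) (g : E) :
    ‖diagOp b m g‖ ≤ C * ‖g‖ := by
  have hC : 0 ≤ C := (norm_nonneg _).trans (hm 0)
  refine le_of_sq_le_sq ?_ (by positivity)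
  rw [mul_pow]
  refine hasSum_le (fun j => ?_) (hasSum_norm_inner_sq b _) ((hasSum_norm_inner_sq b g).mul_left _)
  rw [inner_diagOp b hm, norm_mul, mul_pow]
  gcongr
  exact hm j

theorem diagOp_one (b : HilbertBasis ℕ ℂ E) (g : E) : diagOp b (fun _ => 1) g = g := by
  have h := b.hasSum_repr g
  simp only [b.repr_apply_apply] at h
  simpa [diagOp] using h.tsum_eq

/-- Continuity of the multipliers need not be uniform in the index. By Parseval the squared
increment is a series dominated by (2C)² times the summable squared coefficients of the fixed
vector, so dominated convergence applies. -/
theorem continuous_diagOp (b : HilbertBasis ℕ ℂ E) {m : ℝ → ℕ → ℂ} {C : ℝ}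
    (hm : ∀ t j, ‖m t j‖ ≤ C) (hc : ∀ j, Continuous fun t => m t j) (g : E) :
    Continuous fun t => diagOp b (m t) g := by
  refine continuous_iff_continuousAt.2 fun s => ?_
  have hC : 0 ≤ C := (norm_nonneg _).trans (hm 0 0)
  rw [ContinuousAt, tendsto_iff_norm_sub_tendsto_zero]
  have hsq : ∀ t, ‖diagOp b (m t) g - diagOp b (m s) g‖ ^ 2
      = ∑' j, ‖m t j - m s j‖ ^ 2 * ‖inner ℂ (b j) g‖ ^ 2 := fun t => by
    rw [← (hasSum_norm_inner_sq b _).tsum_eq]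
    refine tsum_congr fun j => ?_
    rw [inner_sub_right, inner_diagOp b (hm t), inner_diagOp b (hm s), ← sub_mul, norm_mul, mul_pow]
  have h0 : Filter.Tendsto (fun t => ‖diagOp b (m t) g - diagOp b (m s) g‖ ^ 2) (nhds s)
      (nhds (∑' _ : ℕ, 0)) := by
    simp only [hsq]
    refine tendsto_tsum_of_dominated_convergence
      (bound := fun j => (C + C) ^ 2 * ‖inner ℂ (b j) g‖ ^ 2)
      ((summable_norm_inner_sq b g).mul_left _) (fun j => ?_)
      (Filter.Eventually.of_forall fun t j => ?_)
    · have : Continuous fun t => ‖m t j - m s j‖ ^ 2 * ‖inner ℂ (b j) g‖ ^ 2 :=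
        (((hc j).sub continuous_const).norm.pow 2).mul continuous_const
      simpa using this.tendsto s
    · rw [Real.norm_of_nonneg (by positivity)]
      gcongr
      exact (norm_sub_le _ _).trans (add_le_add (hm t j) (hm s j))
  simpa [Function.comp_def] using (Real.continuous_sqrt.tendsto _).comp h0

/-- The semigroup `S(t) = exp(t diag(σ))`, frozen at `t = 0` for negative times. -/
def diagSemigroup (b : HilbertBasis ℕ ℂ E) (σ : ℕ → ℂ) (t : ℝ) (g : E) : E :=
  diagOp b (fun j => Complex.exp (σ j * (max t 0 : ℝ))) g

theorem norm_exp_mul_le {σ : ℂ} {η : ℝ} (hσ : σ.re ≤ -η) {t : ℝ} (ht : 0 ≤ t) :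
    ‖Complex.exp (σ * t)‖ ≤ Real.exp (-η * t) := by
  rw [Complex.norm_exp, Real.exp_le_exp]
  simpa using mul_le_mul_of_nonneg_right hσ ht

theorem norm_diagSemigroup_le (b : HilbertBasis ℕ ℂ E) {σ : ℕ → ℂ} {η : ℝ}
    (hσ : ∀ j, (σ j).re ≤ -η) {t : ℝ} (ht : 0 ≤ t) (g : E) :
    ‖diagSemigroup b σ t g‖ ≤ Real.exp (-η * t) * ‖g‖ := by
  refine norm_diagOp_le b (fun j => ?_) g
  rw [max_eq_left ht]
  exact norm_exp_mul_le (hσ j) ht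

theorem norm_semigroup_multiplier_le {σ : ℕ → ℂ} (hσ : ∀ j, (σ j).re ≤ 0) (t : ℝ) (j : ℕ) :
    ‖Complex.exp (σ j * (max t 0 : ℝ))‖ ≤ 1 := by
  simpa using norm_exp_mul_le (η := 0) (by simpa using hσ j) (le_max_right t 0)

theorem diagSemigroup_zero (b : HilbertBasis ℕ ℂ E) (σ : ℕ → ℂ) (g : E) :
    diagSemigroup b σ 0 g = g := by
  simpa [diagSemigroup] using diagOp_one b g

theorem continuous_diagSemigroup (b : HilbertBasis ℕ ℂ E) {σ : ℕ → ℂ} (hσ : ∀ j, (σ j).re ≤ 0)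
    (g : E) : Continuous fun t => diagSemigroup b σ t g :=
  continuous_diagOp b (norm_semigroup_multiplier_le hσ) (fun j => by fun_prop) g

/-- If the functionals `A`, `B` satisfy `B b_j = σ_j A b_j`, then `A (S(t) g)` has derivative
`B (S(t) g)` in the integrated sense. -/
theorem diagSemigroup_evolution [CompleteSpace E] (b : HilbertBasis ℕ ℂ E) {σ : ℕ → ℂ}
    (hσ : ∀ j, (σ j).re ≤ 0) (A B : E →L[ℂ] ℂ) (hAB : ∀ j, B (b j) = σ j * A (b j))
    {t : ℝ} (ht : 0 ≤ t) (g : E) :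
    A (diagSemigroup b σ t g) = A g + ∫ s in (0 : ℝ)..t, B (diagSemigroup b σ s g) := by
  have hexp : ∀ (F : E →L[ℂ] ℂ) (s : ℝ), HasSum
      (fun j => Complex.exp (σ j * (max s 0 : ℝ)) * inner ℂ (b j) g * F (b j))
      (F (diagSemigroup b σ s g)) := fun F s => by
    simpa [diagSemigroup] using (hasSum_diagOp b (norm_semigroup_multiplier_le hσ s) g).mapL F
  -- The numbers σ_j may be unbounded, but by Riesz representation the values of the bounded
  -- functional `B` on the basis are square summable. Their products with the coefficients of g are
  -- thus summable and dominate the integrands uniformly in time.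
  have hsumm : Summable fun j => ‖inner ℂ (b j) g‖ * ‖B (b j)‖ := by
    have h1 : ∀ j, ‖B (b j)‖ = ‖inner ℂ (b j) ((InnerProductSpace.toDual ℂ E).symm B)‖ := fun j => by
      rw [norm_inner_symm, InnerProductSpace.toDual_symm_apply]
    simp only [h1]
    refine Summable.of_nonneg_of_le (fun j => by positivity) (fun j => ?_)
      ((summable_norm_inner_sq b g).add
        (summable_norm_inner_sq b ((InnerProductSpace.toDual ℂ E).symm B)))
    nlinarith [sq_nonneg (‖inner ℂ (b j) g‖ -
      ‖inner ℂ (b j) ((InnerProductSpace.toDual ℂ E).symm B)‖), sq_nonneg ‖inner ℂ (b j) g‖,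
      sq_nonneg ‖inner ℂ (b j) ((InnerProductSpace.toDual ℂ E).symm B)‖]
  have hint : HasSum (fun j => ∫ s in (0 : ℝ)..t,
      Complex.exp (σ j * (max s 0 : ℝ)) * inner ℂ (b j) g * B (b j))
      (∫ s in (0 : ℝ)..t, B (diagSemigroup b σ s g)) := by
    refine intervalIntegral.hasSum_integral_of_dominated_convergence
      (fun j _ => ‖inner ℂ (b j) g‖ * ‖B (b j)‖) (fun j => ?_)
      (fun j => Filter.Eventually.of_forall fun s _ => ?_)
      (Filter.Eventually.of_forall fun s _ => hsumm) (by simp)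
      (Filter.Eventually.of_forall fun s _ => hexp B s)
    · exact Continuous.aestronglyMeasurable (by fun_prop)
    · rw [norm_mul, norm_mul, mul_assoc]
      exact mul_le_of_le_one_left (by positivity) (norm_semigroup_multiplier_le hσ s j)
  have hterm : ∀ j, ∫ s in (0 : ℝ)..t,
      Complex.exp (σ j * (max s 0 : ℝ)) * inner ℂ (b j) g * B (b j)
      = Complex.exp (σ j * (max t 0 : ℝ)) * inner ℂ (b j) g * A (b j)
        - Complex.exp (σ j * (max 0 0 : ℝ)) * inner ℂ (b j) g * A (b j) := fun j => by
    have h1 : ∫ s in (0 : ℝ)..t, Complex.exp (σ j * (max s 0 : ℝ)) * inner ℂ (b j) g * B (b j)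
        = ∫ s in (0 : ℝ)..t,
          Complex.exp (σ j * s) * σ j * (inner ℂ (b j) g * A (b j)) := by
      refine intervalIntegral.integral_congr fun s hs => ?_
      rw [uIcc_of_le ht] at hs
      simp only [max_eq_left hs.1, hAB]
      ring
    have h2 : ∀ s : ℝ, HasDerivAt (fun s : ℝ => Complex.exp (σ j * s)) (Complex.exp (σ j * s) * σ j) s :=
      fun s => by
        simpa using ((Complex.ofRealCLM.hasDerivAt (x := s)).const_mul (σ j)).cexp
    rw [h1, intervalIntegral.integral_mul_const, intervalIntegral.integral_eq_sub_of_hasDerivAt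
      (fun s _ => h2 s) (Continuous.intervalIntegrable (by fun_prop) _ _), max_eq_left ht, max_self]
    ring
  simp only [hterm] at hint
  have h := ((hexp A t).sub (hexp A 0)).unique hint
  rw [diagSemigroup_zero] at h
  rw [← h]
  ring

end DiagonalSemigroup

/-! ### Order of integration on a triangle -/

section Fubini

/-- Interchange of the order of integration on the triangle `0 ≤ y ≤ ξ ≤ x`. -/
theorem integral_triangle_swap {x : ℝ} (hx : 0 ≤ x) {F : ℝ → ℝ → ℂ}
    (hF : Integrable (Function.uncurry F)
      ((volume.restrict (Ioc 0 x)).prod (volume.restrict (Ioc 0 x)))) :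
    ∫ y in (0 : ℝ)..x, ∫ ξ in y..x, F ξ y = ∫ ξ in (0 : ℝ)..x, ∫ y in (0 : ℝ)..ξ, F ξ y := by
  have hm : MeasurableSet {p : ℝ × ℝ | p.2 ≤ p.1} := measurableSet_le measurable_snd measurable_fst
  have h := integral_integral_swap (f := fun ξ y => {p : ℝ × ℝ | p.2 ≤ p.1}.indicator
    (Function.uncurry F) (ξ, y)) (hF.indicator hm)
  rw [intervalIntegral.integral_of_le hx, intervalIntegral.integral_of_le hx]
  convert h.symm using 1
  · refine setIntegral_congr_fun measurableSet_Ioc fun y hy => ?_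
    have h1 : (fun ξ => {p : ℝ × ℝ | p.2 ≤ p.1}.indicator (Function.uncurry F) (ξ, y))
        = (Ici y).indicator (fun ξ => F ξ y) := by
      funext ξ
      simp [indicator_apply]
    simp only [h1]
    rw [setIntegral_indicator measurableSet_Ici, intervalIntegral.integral_of_le hy.2,
      ← integral_Icc_eq_integral_Ioc]
    congr 2
    ext ξ
    simp only [mem_Icc, mem_inter_iff, mem_Ioc, mem_Ici]
    exact ⟨fun h => ⟨⟨hy.1.trans_le h.1, h.2⟩, h.1⟩, fun h => ⟨h.2, h.1.2⟩⟩
  · refine setIntegral_congr_fun measurableSet_Ioc fun ξ hξ => ?_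
    have h1 : (fun y => {p : ℝ × ℝ | p.2 ≤ p.1}.indicator (Function.uncurry F) (ξ, y))
        = (Iic ξ).indicator (fun y => F ξ y) := by
      funext y
      simp [indicator_apply]
    simp only [h1]
    rw [setIntegral_indicator measurableSet_Iic, intervalIntegral.integral_of_le hξ.1.le]
    congr 2
    ext y
    simp only [mem_inter_iff, mem_Ioc, mem_Iic]
    exact ⟨fun h => ⟨⟨h.1, h.2.trans hξ.2⟩, h.2⟩, fun h => ⟨h.1.1, h.2⟩⟩

end Fubini

/-! ### Primitives of L² functions and H¹ functions vanishing at 0 -/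

section Primitive

variable {L : ℝ}

theorem integrable_L2 (g : L2 L) : Integrable g (volume.restrict (Ioo 0 L)) :=
  (Lp.memLp g).integrable (by norm_num)

theorem intervalIntegral_eq_Ioo (hL : 0 ≤ L) (f : ℝ → ℂ) :
    ∫ x in (0 : ℝ)..L, f x = ∫ x in Ioo 0 L, f x := by
  rw [intervalIntegral.integral_of_le hL, integral_Ioc_eq_integral_Ioo]

theorem intervalIntegrable_L2 (g : L2 L) {x : ℝ} (hx : x ∈ Icc 0 L) :
    IntervalIntegrable g volume 0 x := by
  rw [intervalIntegrable_iff_integrableOn_Ioo_of_le hx.1]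
  exact IntegrableOn.mono_set (t := Ioo 0 L) (integrable_L2 g) (Ioo_subset_Ioo_right hx.2)

theorem continuousOn_primitive_L2 (g : L2 L) :
    ContinuousOn (fun x => ∫ y in (0 : ℝ)..x, g y) (Icc 0 L) := by
  have h : IntegrableOn g (Icc 0 L) := by
    rw [integrableOn_Icc_iff_integrableOn_Ioo]
    exact integrable_L2 g
  exact (intervalIntegral.continuousOn_primitive h).congr
    fun x hx => intervalIntegral.integral_of_le hx.1

/-- Hölder's inequality on a bounded interval; `max L 0` is its length whatever the sign of L. -/
theorem integral_norm_L2_le (g : L2 L) :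
    ∫ x in Ioo 0 L, ‖g x‖ ≤ Real.sqrt (max L 0) * ‖g‖ := by
  have h := eLpNorm_le_eLpNorm_mul_rpow_measure_univ (p := 1) (q := 2) (by norm_num)
    (Lp.aestronglyMeasurable g)
  have h1 : ∫ x in Ioo 0 L, ‖g x‖ = (eLpNorm g 1 (volume.restrict (Ioo 0 L))).toReal := by
    rw [toReal_eLpNorm (Lp.aestronglyMeasurable g)]
    simp [lpNorm_one_eq_integral_norm (Lp.aestronglyMeasurable g)]
  rw [h1, Lp.norm_def]
  refine (ENNReal.toReal_mono ?_ h).trans (le_of_eq ?_)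
  · refine ENNReal.mul_ne_top (Lp.eLpNorm_ne_top g) (ENNReal.rpow_ne_top_of_nonneg (by norm_num) ?_)
    simp
  · rw [ENNReal.toReal_mul, mul_comm, ← ENNReal.toReal_rpow, Real.sqrt_eq_rpow]
    simp [ENNReal.toReal_ofReal']
    norm_num

theorem norm_primitive_L2_le (g : L2 L) {x : ℝ} (hx : x ∈ Icc 0 L) :
    ‖∫ y in (0 : ℝ)..x, g y‖ ≤ Real.sqrt (max L 0) * ‖g‖ := by
  refine le_trans ?_ (integral_norm_L2_le g)
  rw [intervalIntegral.integral_of_le hx.1, integral_Ioc_eq_integral_Ioo]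
  refine (norm_integral_le_integral_norm _).trans ?_
  exact setIntegral_mono_set (integrable_L2 g).norm (Filter.Eventually.of_forall fun _ => norm_nonneg _)
    (Ioo_subset_Ioo_right hx.2).eventuallyLE

theorem memLp_of_continuousOn {f : ℝ → ℂ} (hf : ContinuousOn f (Icc 0 L)) :
    MemLp f 2 (volume.restrict (Ioo 0 L)) := by
  obtain ⟨C, hC⟩ := isCompact_Icc.exists_bound_of_continuousOn hf
  refine MemLp.of_bound ((hf.mono Ioo_subset_Icc_self).aestronglyMeasurable measurableSet_Ioo) C ?_
  filter_upwards [ae_restrict_mem measurableSet_Ioo] with x hx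
  exact hC x (Ioo_subset_Icc_self hx)

/-- The Volterra operator `g ↦ ∫₀ˣ g` on `L²(0, L)`. -/
def volterra (L : ℝ) : L2 L →L[ℂ] L2 L :=
  LinearMap.mkContinuous
    { toFun := fun g => (memLp_of_continuousOn (continuousOn_primitive_L2 g)).toLp _
      map_add' := fun f g => by
        rw [← MemLp.toLp_add, MemLp.toLp_eq_toLp_iff]
        filter_upwards [ae_restrict_mem measurableSet_Ioo] with x hx
        have hx' := Ioo_subset_Icc_self hx
        rw [Pi.add_apply, ← intervalIntegral.integral_add (intervalIntegrable_L2 f hx')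
          (intervalIntegrable_L2 g hx')]
        simp only [intervalIntegral.integral_of_le hx.1.le, integral_Ioc_eq_integral_Ioo]
        exact integral_congr_ae
          (ae_restrict_of_ae_restrict_of_subset (Ioo_subset_Ioo_right hx.2.le) (Lp.coeFn_add f g))
      map_smul' := fun c g => by
        rw [RingHom.id_apply, ← MemLp.toLp_const_smul, MemLp.toLp_eq_toLp_iff]
        filter_upwards [ae_restrict_mem measurableSet_Ioo] with x hx
        rw [Pi.smul_apply, ← intervalIntegral.integral_smul]
        simp only [intervalIntegral.integral_of_le hx.1.le, integral_Ioc_eq_integral_Ioo]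
        exact integral_congr_ae
          (ae_restrict_of_ae_restrict_of_subset (Ioo_subset_Ioo_right hx.2.le)
            (Lp.coeFn_smul c g)) }
    (((volume.restrict (Ioo 0 L)).real univ) ^ ((2 : ENNReal).toReal)⁻¹ * Real.sqrt (max L 0))
    fun g => by
      rw [mul_assoc]
      refine Lp.norm_le_of_ae_bound (by positivity) ?_
      filter_upwards [(memLp_of_continuousOn (continuousOn_primitive_L2 g)).coeFn_toLp,
        ae_restrict_mem measurableSet_Ioo] with x hx hx'
      simp only [LinearMap.coe_mk, AddHom.coe_mk]
      rw [hx]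
      exact norm_primitive_L2_le g (Ioo_subset_Icc_self hx')

theorem volterra_ae (g : L2 L) :
    volterra L g =ᵐ[volume.restrict (Ioo 0 L)] fun x => ∫ y in (0 : ℝ)..x, g y :=
  (memLp_of_continuousOn (continuousOn_primitive_L2 g)).coeFn_toLp

/-- The weak formulation pairs bilinearly, while the inner product is conjugate linear in its first
slot, so the representing vector is the conjugate of ψ. -/
theorem exists_pairing (L : ℝ) {ψ : ℝ → ℂ} (hψ : Continuous ψ) :
    ∃ A : L2 L →L[ℂ] ℂ, ∀ g, A g = ∫ x in Ioo 0 L, g x * ψ x := by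
  have hc : MemLp (fun x => starRingEnd ℂ (ψ x)) 2 (volume.restrict (Ioo 0 L)) :=
    memLp_of_continuousOn (Complex.continuous_conj.comp hψ).continuousOn
  refine ⟨innerSL ℂ (hc.toLp _), fun g => ?_⟩
  rw [innerSL_apply_apply, L2.inner_def]
  refine integral_congr_ae ?_
  filter_upwards [hc.coeFn_toLp] with x hx
  simp [hx]

/-- Integration by parts for the primitive of an `L²` function. -/
theorem integral_volterra_mul_deriv (hL : 0 ≤ L) (g : L2 L) {φ : ℝ → ℂ} (hφ : ContDiff ℝ 1 φ) :
    ∫ x in Ioo 0 L, volterra L g x * deriv φ x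
      = (∫ x in Ioo 0 L, g x) * φ L - ∫ x in Ioo 0 L, g x * φ x := by
  have hd : Continuous (deriv φ) := hφ.continuous_deriv le_rfl
  -- Swapping the order of integration replaces differentiation of the primitive: for fixed y the
  -- inner integral of φ' over [y, L] is φ(L) - φ(y).
  have hint : Integrable (Function.uncurry fun ξ y => deriv φ ξ * g y)
      ((volume.restrict (Ioc 0 L)).prod (volume.restrict (Ioc 0 L))) := by
    refine Integrable.mul_prod ?_ ?_
    · exact (hd.integrableOn_Icc).mono_set Ioc_subset_Icc_self
    · rw [← IntegrableOn, integrableOn_Ioc_iff_integrableOn_Ioo]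
      exact integrable_L2 g
  have hsw := integral_triangle_swap hL hint
  have h1 : ∫ x in Ioo 0 L, volterra L g x * deriv φ x
      = ∫ x in (0 : ℝ)..L, ∫ y in (0 : ℝ)..x, deriv φ x * g y := by
    rw [intervalIntegral_eq_Ioo hL]
    refine integral_congr_ae ?_
    filter_upwards [volterra_ae g] with x hx
    rw [hx, intervalIntegral.integral_const_mul, mul_comm]
  rw [h1, ← hsw, intervalIntegral_eq_Ioo hL, ← integral_mul_const,
    ← integral_sub ((integrable_L2 g).mul_const _) (integrable_mul_cont L g hφ.continuous)]
  refine integral_congr_ae (Filter.Eventually.of_forall fun y => ?_)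
  simp only
  rw [intervalIntegral.integral_mul_const, intervalIntegral.integral_eq_sub_of_hasDerivAt
    (fun x _ => (hφ.differentiable one_ne_zero x).hasDerivAt) (hd.intervalIntegrable _ _)]
  ring

theorem isWeakDeriv_volterra (hL : 0 ≤ L) (g : L2 L) : IsWeakDeriv L (volterra L g) g := by
  intro φ h1 _ h3
  have h0 : φ L = 0 := image_eq_zero_of_notMem_tsupport fun h => (h3 h).2.false
  rw [integral_volterra_mul_deriv hL g (h1.of_le (by simp)), h0, mul_zero, zero_sub]

/-- The map `g ↦ ∫₀ˣ g` from `L²(0, L)` onto the functions in `H¹(0, L)` vanishing at `0`. -/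
def primitiveH1 (hL : 0 ≤ L) : L2 L →L[ℂ] H1 L :=
  ((WithLp.prodContinuousLinearEquiv 2 ℂ (L2 L) (L2 L)).symm.toContinuousLinearMap.comp
    ((volterra L).prod (ContinuousLinearMap.id ℂ (L2 L)))).codRestrict (H1 L)
      fun g => isWeakDeriv_volterra hL g

@[simp] theorem fn_primitiveH1 (hL : 0 ≤ L) (g : L2 L) : fn (primitiveH1 hL g) = volterra L g := rfl

theorem H1_ext {u v : H1 L} (h1 : fn u = fn v) (h2 : dx u = dx v) : u = v :=
  Subtype.ext ((WithLp.equiv 2 (L2 L × L2 L)).injective (Prod.ext h1 h2))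

theorem vanishesAtZero_primitiveH1 (hL : 0 ≤ L) (g : L2 L) : VanishesAtZero (primitiveH1 hL g) :=
  ⟨_, continuousOn_primitive_L2 g, volterra_ae g, by simp⟩

theorem norm_dx_le (u : H1 L) : ‖dx u‖ ≤ ‖u‖ :=
  WithLp.norm_snd_le _ _

theorem continuous_fn : Continuous (fn : H1 L → L2 L) :=
  (WithLp.prod_continuous_ofLp 2 _ _).fst.comp continuous_subtype_val

/-! ### The Du Bois-Reymond lemma -/

section DuBoisReymond

/-- Du Bois-Reymond: a function orthogonal to all derivatives of test functions is constant. -/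
theorem ae_const_of_integral_mul_deriv_eq_zero (hL : 0 < L) {h : ℝ → ℂ}
    (hh : IntegrableOn h (Ioo 0 L))
    (H : ∀ φ : ℝ → ℝ, ContDiff ℝ ∞ φ → HasCompactSupport φ → tsupport φ ⊆ Ioo 0 L →
      ∫ x in Ioo 0 L, h x * (deriv φ x : ℝ) = 0) :
    ∃ c : ℂ, ∀ᵐ x ∂volume.restrict (Ioo 0 L), h x = c := by
  -- The normalized bump has integral 1 and support [L/4, 3L/4]. The constant sought is the integral
  -- of h against it.
  let b : ContDiffBump (L / 2) := ⟨L / 8, L / 4, by positivity, by linarith⟩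
  set φ₀ : ℝ → ℝ := b.normed volume with hφ₀
  have hφ₀c : ContDiff ℝ ∞ φ₀ := b.contDiff_normed
  have hφ₀s : tsupport φ₀ ⊆ Ioo 0 L := by
    rw [hφ₀, b.tsupport_normed_eq, Real.closedBall_eq_Icc]
    intro x hx
    simp only [b, mem_Icc] at hx
    constructor <;> linarith [hx.1, hx.2]
  have hφ₀k : HasCompactSupport φ₀ := b.hasCompactSupport_normed
  have hint : ∀ ψ : ℝ → ℝ, Continuous ψ → IntegrableOn (fun x => h x * (ψ x : ℂ)) (Ioo 0 L) := by
    intro ψ hψ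
    obtain ⟨C, hC⟩ := isCompact_Icc.exists_bound_of_continuousOn (s := Icc (0 : ℝ) L)
      hψ.continuousOn
    refine Integrable.mul_bdd (c := C) hh
      (Complex.continuous_ofReal.comp hψ).aestronglyMeasurable ?_
    filter_upwards [ae_restrict_mem measurableSet_Ioo] with x hx
    rw [Complex.norm_real]
    exact hC x (Ioo_subset_Icc_self hx)
  set c : ℂ := ∫ x in Ioo 0 L, h x * (φ₀ x : ℂ) with hc
  refine ⟨c, ?_⟩
  have hloc : LocallyIntegrableOn (fun x => h x - c) (Ioo 0 L) :=
    (hh.sub (integrableOn_const (by simp))).locallyIntegrableOn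
  suffices H' : ∀ g : ℝ → ℝ, ContDiff ℝ ∞ g → HasCompactSupport g → tsupport g ⊆ Ioo 0 L →
      ∫ x, g x • (h x - c) = 0 by
    rw [ae_restrict_iff' measurableSet_Ioo]
    filter_upwards [isOpen_Ioo.ae_eq_zero_of_integral_contDiff_smul_eq_zero hloc H'] with x hx hx'
    exact sub_eq_zero.1 (hx hx')
  intro g hg hgk hgs
  set I : ℝ := ∫ x, g x with hI
  -- Subtracting the right multiple of the bump makes the mean zero, so the primitive of ψ vanishes
  -- on both sides of the support of ψ and is itself an admissible test function.
  set ψ : ℝ → ℝ := fun x => g x - I * φ₀ x with hψ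
  have hψc : ContDiff ℝ ∞ ψ := hg.sub (contDiff_const.mul hφ₀c)
  have hψ0 : ∫ x, ψ x = 0 := by
    rw [hψ, integral_sub (hg.continuous.integrable_of_hasCompactSupport hgk)
      ((hφ₀c.continuous.integrable_of_hasCompactSupport hφ₀k).const_mul _), integral_const_mul,
      b.integral_normed, mul_one, sub_self]
  obtain ⟨α, β, hα, hβ, hαβ, hsupp⟩ : ∃ α β : ℝ, 0 < α ∧ β < L ∧ α ≤ β ∧
      ∀ x, x ∉ Icc α β → ψ x = 0 := by
    have hK : IsCompact (tsupport g ∪ tsupport φ₀) := IsCompact.union hgk hφ₀k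
    have hne : (tsupport g ∪ tsupport φ₀).Nonempty := by
      refine ⟨L / 2, Or.inr (subset_tsupport _ ?_)⟩
      rw [hφ₀, b.support_normed_eq]
      exact Metric.mem_ball_self b.rOut_pos
    obtain ⟨α, hα⟩ := hK.exists_isLeast hne
    obtain ⟨β, hβ⟩ := hK.exists_isGreatest hne
    refine ⟨α, β, ?_, ?_, hα.2 hβ.1, fun x hx => ?_⟩
    · exact (union_subset hgs hφ₀s hα.1).1
    · exact (union_subset hgs hφ₀s hβ.1).2
    · have hx' : x ∉ tsupport g ∪ tsupport φ₀ := fun h' => hx ⟨hα.2 h', hβ.2 h'⟩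
      rw [mem_union, not_or] at hx'
      simp [hψ, image_eq_zero_of_notMem_tsupport hx'.1, image_eq_zero_of_notMem_tsupport hx'.2]
  set Φ : ℝ → ℝ := fun x => ∫ y in (0 : ℝ)..x, ψ y with hΦ
  have hΦd : ∀ x, HasDerivAt Φ (ψ x) x := fun x =>
    intervalIntegral.integral_hasDerivAt_right (hψc.continuous.intervalIntegrable _ _)
      (hψc.continuous.stronglyMeasurableAtFilter _ _) hψc.continuous.continuousAt
  have hΦ' : deriv Φ = ψ := funext fun x => (hΦd x).deriv
  have hΦc : ContDiff ℝ ∞ Φ := by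
    rw [contDiff_infty_iff_deriv, hΦ']
    exact ⟨fun x => (hΦd x).differentiableAt, hψc⟩
  have hΦsub : tsupport Φ ⊆ Icc α β := by
    refine closure_minimal (fun x hx => ?_) isClosed_Icc
    by_contra hx'
    refine hx ?_
    rw [mem_Icc, not_and_or, not_le, not_le] at hx'
    rcases hx' with hx' | hx'
    · refine intervalIntegral.integral_zero_ae (Filter.Eventually.of_forall fun y hy => ?_)
      refine hsupp y fun h' => ?_
      rcases mem_uIoc.1 hy with hy | hy <;> linarith [hy.1, hy.2, h'.1]
    · simp only [hΦ]
      rw [intervalIntegral.integral_eq_integral_of_support_subset, hψ0]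
      intro y hy
      have : y ∈ Icc α β := by
        by_contra h'
        exact hy (hsupp y h')
      exact ⟨hα.trans_le this.1, this.2.trans hx'.le⟩
  have key := H Φ hΦc (HasCompactSupport.of_support_subset_isCompact isCompact_Icc
    ((subset_tsupport _).trans hΦsub)) (hΦsub.trans (Icc_subset_Ioo hα hβ))
  have hgset : ∫ x in Ioo 0 L, (g x : ℂ) = I := by
    rw [setIntegral_eq_integral_of_forall_compl_eq_zero]
    · exact integral_ofReal
    intro x hx
    rw [image_eq_zero_of_notMem_tsupport fun h' => hx (hgs h'), Complex.ofReal_zero]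
  have hzero : ∫ x, g x • (h x - c) = ∫ x in Ioo 0 L, (h x * (g x : ℂ) - c * (g x : ℂ)) := by
    rw [← setIntegral_eq_integral_of_forall_compl_eq_zero (s := Ioo 0 L)]
    · refine integral_congr_ae (Filter.Eventually.of_forall fun x => ?_)
      simp only [Complex.real_smul]
      ring
    · intro x hx
      rw [image_eq_zero_of_notMem_tsupport fun h' => hx (hgs h'), zero_smul]
  have key2 : ∫ x in Ioo 0 L, (h x * (g x : ℂ) - I * (h x * (φ₀ x : ℂ))) = 0 := by
    rw [← key, hΦ']
    refine integral_congr_ae (Filter.Eventually.of_forall fun x => ?_)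
    simp only [hψ]
    push_cast
    ring
  have hgi : IntegrableOn (fun x => (g x : ℂ)) (Ioo 0 L) :=
    ((hg.continuous.integrable_of_hasCompactSupport hgk).ofReal).integrableOn
  rw [integral_sub (hint g hg.continuous) ((hint φ₀ hφ₀c.continuous).const_mul _),
    integral_const_mul, ← hc] at key2
  rw [hzero, integral_sub (hint g hg.continuous) (hgi.const_mul _), integral_const_mul, hgset,
    ← key2]
  ring

end DuBoisReymond

/-- An element of `H¹(0, L)` vanishing at `0` is the primitive of its derivative. -/
theorem eq_primitiveH1_of_vanishesAtZero (hL : 0 < L) {u : H1 L} (hu : VanishesAtZero u) :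
    u = primitiveH1 hL.le (dx u) := by
  refine H1_ext ?_ rfl
  rw [fn_primitiveH1]
  obtain ⟨f, hfc, hf, hf0⟩ := hu
  obtain ⟨c, hc⟩ := ae_const_of_integral_mul_deriv_eq_zero hL
    (h := fun x => fn u x - volterra L (dx u) x) ((integrable_L2 _).sub (integrable_L2 _)) (by
      intro φ h1 h2 h3
      have h1' : ContDiff ℝ ∞ (fun x => (φ x : ℂ)) := Complex.ofRealCLM.contDiff.comp h1
      have hd : ∀ x, deriv (fun x => (φ x : ℂ)) x = (deriv φ x : ℝ) := fun x =>
        ((h1.differentiable (by simp) x).hasDerivAt.ofReal_comp).deriv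
      have hsupp : tsupport (fun x => (φ x : ℂ)) = tsupport φ := by
        simp [tsupport, Function.support]
      have h2' : HasCompactSupport (fun x => (φ x : ℂ)) := h2.comp_left Complex.ofReal_zero
      have ha := u.2 _ h1' h2' (hsupp ▸ h3)
      have hb := isWeakDeriv_volterra hL.le (dx u) _ h1' h2' (hsupp ▸ h3)
      have hcont := h1'.continuous_deriv (by simp)
      simp only [← hd, sub_mul]
      rw [integral_sub (integrable_mul_cont L _ hcont) (integrable_mul_cont L _ hcont), hb]
      exact sub_eq_zero.2 ha)
  -- Du Bois-Reymond gives a constant only almost everywhere. Continuity of D carries the equality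
  -- up to the endpoint 0, where D vanishes, so the constant is 0.
  set D : ℝ → ℂ := fun x => f x - ∫ y in (0 : ℝ)..x, dx u y with hD
  have hDc : ContinuousOn D (Icc 0 L) := hfc.sub (continuousOn_primitive_L2 _)
  have hDae : D =ᵐ[volume.restrict (Ioo 0 L)] fun _ => c := by
    filter_upwards [hc, hf, volterra_ae (dx u)] with x h1 h2 h3
    rw [← h1, hD, h2, h3]
  have hEq : EqOn D (fun _ => c) (Ioo 0 L) := by
    refine Measure.eqOn_open_of_ae_eq hDae isOpen_Ioo (hDc.mono Ioo_subset_Icc_self)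
      continuousOn_const
  have hEq' : EqOn D (fun _ => c) (Icc 0 L) :=
    hEq.of_subset_closure hDc continuousOn_const Ioo_subset_Icc_self (by rw [closure_Ioo hL.ne])
  have hc0 : c = 0 := by
    have := hEq' (left_mem_Icc.2 hL.le)
    simpa [hD, hf0] using this.symm
  refine Lp.ext ?_
  filter_upwards [hc] with x hx
  rwa [hc0, sub_eq_zero] at hx

end Primitive

/-! ### The sine eigenfunctions and the cosine Hilbert basis -/

section Basis

variable {L : ℝ}

/-- The frequencies `ω_j = (2j-1)π/(2L)`, so that `λ_j = ω_j²`. -/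
def freq (L : ℝ) (j : ℕ) : ℝ := (2 * (j : ℝ) - 1) * Real.pi / (2 * L)

/-- The functions `√(2/L) cos(ω_j x) = e_j' / ω_j`. -/
def cosfun (L : ℝ) (j : ℕ) (x : ℝ) : ℂ := ((Real.sqrt (2 / L) * Real.cos (freq L j * x) : ℝ) : ℂ)

theorem eigfun_eq (L : ℝ) (j : ℕ) (x : ℝ) :
    eigfun L j x = ((Real.sqrt (2 / L) * Real.sin (freq L j * x) : ℝ) : ℂ) := by
  rw [eigfun, freq, div_mul_eq_mul_div]

theorem freq_sq (L : ℝ) (j : ℕ) : freq L j ^ 2 = eigval L j := by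
  rw [freq, eigval]
  ring

theorem freq_pos (hL : 0 < L) {j : ℕ} (hj : 1 ≤ j) : 0 < freq L j := by
  have : (1 : ℝ) ≤ j := by exact_mod_cast hj
  have := Real.pi_pos
  exact div_pos (mul_pos (by linarith) this) (by linarith)

theorem contDiff_eigfun (L : ℝ) (j : ℕ) {n : WithTop ℕ∞} : ContDiff ℝ n (eigfun L j) :=
  Complex.ofRealCLM.contDiff.comp (contDiff_const.mul (Real.contDiff_sin.comp (by fun_prop)))

theorem contDiff_cosfun (L : ℝ) (j : ℕ) {n : WithTop ℕ∞} : ContDiff ℝ n (cosfun L j) :=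
  Complex.ofRealCLM.contDiff.comp (contDiff_const.mul (Real.contDiff_cos.comp (by fun_prop)))

theorem hasDerivAt_eigfun (L : ℝ) (j : ℕ) (x : ℝ) :
    HasDerivAt (eigfun L j) (freq L j * cosfun L j x) x := by
  have h : HasDerivAt (fun x => Real.sqrt (2 / L) * Real.sin (freq L j * x))
      (Real.sqrt (2 / L) * (Real.cos (freq L j * x) * freq L j)) x := by
    simpa using (((hasDerivAt_id x).const_mul (freq L j)).sin.const_mul (Real.sqrt (2 / L)))
  convert h.ofReal_comp using 1
  · exact funext (eigfun_eq L j)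
  · rw [cosfun]
    push_cast
    ring

theorem hasDerivAt_cosfun (L : ℝ) (j : ℕ) (x : ℝ) :
    HasDerivAt (cosfun L j) (-freq L j * eigfun L j x) x := by
  have h : HasDerivAt (fun x => Real.sqrt (2 / L) * Real.cos (freq L j * x))
      (Real.sqrt (2 / L) * (-Real.sin (freq L j * x) * freq L j)) x := by
    simpa using (((hasDerivAt_id x).const_mul (freq L j)).cos.const_mul (Real.sqrt (2 / L)))
  convert h.ofReal_comp using 1
  · rfl
  · rw [eigfun_eq]
    push_cast
    ring

theorem eigfun_zero (L : ℝ) (j : ℕ) : eigfun L j 0 = 0 := by simp [eigfun_eq]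

theorem cosfun_self (hL : 0 < L) (j : ℕ) : cosfun L j L = 0 := by
  have h : freq L j * L = (j : ℤ) * Real.pi - Real.pi / 2 := by
    rw [freq]
    push_cast
    field_simp
  rw [cosfun, h, Real.cos_sub_pi_div_two]
  simp

/-- The function `√(2/L) cos(ω_j x)` as an element of `L²(0, L)`. -/
def cosL2 (L : ℝ) (j : ℕ) : L2 L :=
  (memLp_of_continuousOn (contDiff_cosfun (n := 0) L j).continuous.continuousOn).toLp (cosfun L j)

theorem cosL2_ae (L : ℝ) (j : ℕ) : cosL2 L j =ᵐ[volume.restrict (Ioo 0 L)] cosfun L j :=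
  MemLp.coeFn_toLp _

theorem eigL2_ae (L : ℝ) (j : ℕ) : eigL2 L j =ᵐ[volume.restrict (Ioo 0 L)] eigfun L j :=
  MemLp.coeFn_toLp _

theorem inner_eigL2 (j : ℕ) (u : L2 L) :
    inner ℂ (eigL2 L j) u = ∫ x in Ioo 0 L, u x * eigfun L j x := by
  rw [L2.inner_def]
  refine integral_congr_ae ?_
  filter_upwards [eigL2_ae L j] with x hx
  simp only [hx, eigfun, RCLike.inner_apply, Complex.conj_ofReal]

theorem inner_cosL2 (j : ℕ) (u : L2 L) :
    inner ℂ (cosL2 L j) u = ∫ x in Ioo 0 L, u x * cosfun L j x := by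
  rw [L2.inner_def]
  refine integral_congr_ae ?_
  filter_upwards [cosL2_ae L j] with x hx
  simp only [hx, cosfun, RCLike.inner_apply, Complex.conj_ofReal]

/-- Integration by parts: there is no boundary term at L since ω_j L is an odd multiple of π/2. This
translates between modes of a function and cosine modes of its derivative. -/
theorem inner_cosL2_eq (hL : 0 < L) (j : ℕ) (g : L2 L) :
    inner ℂ (cosL2 L j) g = freq L j * inner ℂ (eigL2 L j) (volterra L g) := by
  have h := integral_volterra_mul_deriv hL.le g (contDiff_cosfun L j)
  rw [cosfun_self hL, mul_zero, zero_sub] at h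
  rw [inner_cosL2, inner_eigL2, ← integral_const_mul, ← neg_neg (∫ x in Ioo 0 L, _), ← h,
    ← integral_neg]
  refine integral_congr_ae (Filter.Eventually.of_forall fun x => ?_)
  simp only [(hasDerivAt_cosfun L j x).deriv]
  ring

theorem smul_volterra_cosL2 (j : ℕ) :
    (freq L j : ℂ) • volterra L (cosL2 L j) = eigL2 L j := by
  refine Lp.ext ?_
  filter_upwards [Lp.coeFn_smul (freq L j : ℂ) (volterra L (cosL2 L j)), volterra_ae (cosL2 L j),
    eigL2_ae L j, ae_restrict_mem measurableSet_Ioo] with x h1 h2 h3 hx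
  have h4 : ∫ y in (0 : ℝ)..x, cosL2 L j y = ∫ y in (0 : ℝ)..x, cosfun L j y := by
    rw [intervalIntegral_eq_Ioo hx.1.le, intervalIntegral_eq_Ioo hx.1.le]
    exact integral_congr_ae
      (ae_restrict_of_ae_restrict_of_subset (Ioo_subset_Ioo_right hx.2.le) (cosL2_ae L j))
  rw [h1, Pi.smul_apply, h2, h3, h4, smul_eq_mul, ← intervalIntegral.integral_const_mul,
    intervalIntegral.integral_eq_sub_of_hasDerivAt (fun y _ => hasDerivAt_eigfun L j y)
      (Continuous.intervalIntegrable
        (continuous_const.mul (contDiff_cosfun (n := 0) L j).continuous) _ _), eigfun_zero, sub_zero]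

theorem integral_cos_int_mul (hL : 0 < L) (k : ℤ) :
    ∫ x in (0 : ℝ)..L, Real.cos (k * Real.pi / L * x) = if k = 0 then L else 0 := by
  split_ifs with hk
  · simp [hk]
  · have hne : (k : ℝ) * Real.pi / L ≠ 0 :=
      div_ne_zero (mul_ne_zero (by exact_mod_cast hk) Real.pi_ne_zero) hL.ne'
    rw [intervalIntegral.integral_comp_mul_left (fun x => Real.cos x) hne, integral_cos,
      div_mul_cancel₀ _ hL.ne', Real.sin_int_mul_pi]
    simp

theorem inner_cosL2_cosL2 (hL : 0 < L) {i j : ℕ} (hi : 1 ≤ i) (hj : 1 ≤ j) :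
    inner ℂ (cosL2 L i) (cosL2 L j) = if i = j then (1 : ℂ) else 0 := by
  have h1 : ∀ x, cosfun L j x * cosfun L i x = (((1 / L) * (Real.cos (((j - i : ℤ) : ℝ) * Real.pi / L * x)
      + Real.cos (((j + i - 1 : ℤ) : ℝ) * Real.pi / L * x)) : ℝ) : ℂ) := fun x => by
    have ha : ((j - i : ℤ) : ℝ) * Real.pi / L * x = freq L j * x - freq L i * x := by
      simp only [freq]; push_cast; field_simp; ring
    have hb : ((j + i - 1 : ℤ) : ℝ) * Real.pi / L * x = freq L j * x + freq L i * x := by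
      simp only [freq]; push_cast; field_simp; ring
    rw [ha, hb, Real.cos_sub, Real.cos_add, cosfun, cosfun, ← Complex.ofReal_mul]
    congr 1
    have hs : Real.sqrt (2 / L) * Real.sqrt (2 / L) = 2 / L := Real.mul_self_sqrt (by positivity)
    linear_combination (Real.cos (freq L j * x) * Real.cos (freq L i * x)) * hs
  have h2 : inner ℂ (cosL2 L i) (cosL2 L j) = ∫ x in Ioo 0 L, cosfun L j x * cosfun L i x := by
    rw [inner_cosL2]
    refine integral_congr_ae ?_
    filter_upwards [cosL2_ae L j] with x hx
    rw [hx]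
  have hc : ∀ c : ℝ, IntervalIntegrable (fun x => Real.cos (c * x)) volume 0 L := fun c =>
    Continuous.intervalIntegrable (by fun_prop) _ _
  rw [h2, ← intervalIntegral_eq_Ioo hL.le]
  simp only [h1]
  -- The sum frequency has index i + j - 1 ≥ 1, so its integral always vanishes; the difference
  -- frequency contributes only when i = j.
  rw [intervalIntegral.integral_ofReal, intervalIntegral.integral_const_mul,
    intervalIntegral.integral_add (hc _) (hc _), integral_cos_int_mul hL, integral_cos_int_mul hL,
    if_neg (by omega : ¬ (j + i - 1 : ℤ) = 0)]
  by_cases hij : i = j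
  · simp [hij, hL.ne']
  · rw [if_neg (by omega), if_neg hij]
    simp

theorem inner_eigL2_eigL2 (hL : 0 < L) {i j : ℕ} (hi : 1 ≤ i) (hj : 1 ≤ j) :
    inner ℂ (eigL2 L i) (eigL2 L j) = if i = j then (1 : ℂ) else 0 := by
  have hne : (freq L i : ℂ) ≠ 0 := by exact_mod_cast (freq_pos hL hi).ne'
  have h := inner_cosL2_eq hL i (cosL2 L j)
  rw [inner_cosL2_cosL2 hL hi hj] at h
  rw [← smul_volterra_cosL2 j, inner_smul_right]
  refine mul_left_cancel₀ hne ?_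
  rw [mul_left_comm, ← h]
  by_cases hij : i = j <;> simp [hij]

theorem orthonormal_cosL2 (hL : 0 < L) : Orthonormal ℂ fun n : ℕ => cosL2 L (n + 1) := by
  rw [orthonormal_iff_ite]
  intro i j
  rw [inner_cosL2_cosL2 hL (by omega) (by omega)]
  simp

/-- Let C_k be the cosine of frequency (2k+1)π/(2L) and y = cos(πx/L). As y C_k = (C_{k+1} +
C_{k-1})/2, orthogonality to every C_k gives orthogonality to p(y) C_0 for each polynomial p. Since
x is a continuous function of y on [0, L], Weierstrass approximation extends this to f C_0 with f
continuous. Hence g C_0 = 0 almost everywhere, and C_0 > 0 on (0, L). -/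
theorem cosL2_complete (hL : 0 < L) {g : L2 L} (hg : ∀ j, 1 ≤ j → inner ℂ (cosL2 L j) g = 0) :
    g = 0 := by
  set C : ℤ → ℝ → ℝ := fun k x => Real.cos ((2 * k + 1) * Real.pi / (2 * L) * x) with hC
  set y : ℝ → ℝ := fun x => Real.cos (Real.pi / L * x) with hy
  have hCc : ∀ k, Continuous (C k) := fun k => by fun_prop
  have hyc : Continuous y := by fun_prop
  have hint : ∀ f : ℝ → ℝ, Continuous f →
      Integrable (fun x => g x * (f x : ℂ)) (volume.restrict (Ioo 0 L)) := fun f hf =>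
    integrable_mul_cont L g (Complex.continuous_ofReal.comp hf)
  have hnat : ∀ n : ℕ, ∫ x in Ioo 0 L, g x * (C n x : ℂ) = 0 := fun n => by
    have h := hg (n + 1) (by omega)
    have hs : (Real.sqrt (2 / L) : ℂ) ≠ 0 := by
      exact_mod_cast (Real.sqrt_pos.2 (by positivity)).ne'
    rw [inner_cosL2] at h
    refine (mul_eq_zero.1 (?_ : (Real.sqrt (2 / L) : ℂ) * _ = 0)).resolve_left hs
    rw [← integral_const_mul, ← h]
    refine integral_congr_ae (Filter.Eventually.of_forall fun x => ?_)
    simp only [cosfun, hC, freq]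
    push_cast
    ring_nf
  have hint0 : ∀ k : ℤ, ∫ x in Ioo 0 L, g x * (C k x : ℂ) = 0 := fun k => by
    rcases le_or_gt 0 k with hk | hk
    · lift k to ℕ using hk
      exact hnat k
    -- The reflection k ↦ -k - 1 reverses the sign of 2k + 1, so evenness of the cosine reduces
    -- negative indices to natural ones.
    · obtain ⟨n, rfl⟩ : ∃ n : ℕ, k = -(n : ℤ) - 1 := ⟨(-k - 1).toNat, by omega⟩
      rw [← hnat n]
      refine integral_congr_ae (Filter.Eventually.of_forall fun x => ?_)
      simp only [hC]
      rw [← Real.cos_neg]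
      congr 3
      push_cast
      ring
  have hint1 : ∀ (n : ℕ) (k : ℤ), Integrable (fun x => g x * ((y x ^ n * C k x : ℝ) : ℂ))
      (volume.restrict (Ioo 0 L)) := fun n k => hint _ ((hyc.pow n).mul (hCc k))
  have hint2 : ∀ p : Polynomial ℝ, Integrable (fun x => g x * ((p.eval (y x) * C 0 x : ℝ) : ℂ))
      (volume.restrict (Ioo 0 L)) := fun p => hint _ ((p.continuous.comp hyc).mul (hCc 0))
  have hpow : ∀ (n : ℕ) (k : ℤ), ∫ x in Ioo 0 L, g x * ((y x ^ n * C k x : ℝ) : ℂ) = 0 := by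
    intro n
    induction n with
    | zero => simpa using hint0
    | succ n ih =>
      intro k
      have h2 : ∀ x, g x * ((y x ^ (n + 1) * C k x : ℝ) : ℂ)
          = (1 / 2) * (g x * ((y x ^ n * C (k + 1) x : ℝ) : ℂ))
            + (1 / 2) * (g x * ((y x ^ n * C (k - 1) x : ℝ) : ℂ)) := fun x => by
        have h3 : y x * C k x = (C (k + 1) x + C (k - 1) x) / 2 := by
          simp only [hy, hC]
          have e1 : (2 * ((k + 1 : ℤ) : ℝ) + 1) * Real.pi / (2 * L) * x
              = (2 * k + 1) * Real.pi / (2 * L) * x + Real.pi / L * x := by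
            push_cast; field_simp; ring
          have e2 : (2 * ((k - 1 : ℤ) : ℝ) + 1) * Real.pi / (2 * L) * x
              = (2 * k + 1) * Real.pi / (2 * L) * x - Real.pi / L * x := by
            push_cast; field_simp; ring
          rw [e1, e2, Real.cos_add, Real.cos_sub]
          ring
        rw [pow_succ, mul_assoc, h3]
        push_cast
        ring
      simp only [h2]
      rw [integral_add ((hint1 n _).const_mul _) ((hint1 n _).const_mul _), integral_const_mul, integral_const_mul,
        ih, ih]
      simp
  have hpoly : ∀ p : Polynomial ℝ, ∫ x in Ioo 0 L, g x * ((p.eval (y x) * C 0 x : ℝ) : ℂ) = 0 := by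
    intro p
    induction p using Polynomial.induction_on' with
    | add p q hp hq =>
      have h2 : ∀ x, g x * (((p + q).eval (y x) * C 0 x : ℝ) : ℂ)
          = g x * ((p.eval (y x) * C 0 x : ℝ) : ℂ) + g x * ((q.eval (y x) * C 0 x : ℝ) : ℂ) :=
        fun x => by
          rw [Polynomial.eval_add]
          push_cast
          ring
      simp only [h2]
      rw [integral_add (hint2 p) (hint2 q), hp, hq, add_zero]
    | monomial n a =>
      have h2 : ∀ x, g x * (((Polynomial.monomial n a).eval (y x) * C 0 x : ℝ) : ℂ)
          = a * (g x * ((y x ^ n * C 0 x : ℝ) : ℂ)) := fun x => by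
        rw [Polynomial.eval_monomial]
        push_cast
        ring
      simp only [h2]
      rw [integral_const_mul, hpow, mul_zero]
  have hcont : ∀ f : ℝ → ℝ, Continuous f → ∫ x in Ioo 0 L, g x * ((f x * C 0 x : ℝ) : ℂ) = 0 := by
    intro f hf
    rw [← norm_le_zero_iff]
    refine le_of_forall_pos_le_add fun ε hε => ?_
    rw [zero_add]
    set G : ℝ := ∫ x in Ioo 0 L, ‖g x‖ with hG
    have hG0 : 0 ≤ G := integral_nonneg fun _ => norm_nonneg _
    -- The change of variable x = (L/π) arccos s turns f into a continuous function on [-1, 1]. The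
    -- tolerance uses G + 1 so that the denominator is positive even when g = 0.
    obtain ⟨p, hp⟩ := exists_polynomial_near_of_continuousOn (-1) 1
      (fun s => f (L / Real.pi * Real.arccos s))
      (hf.comp (continuous_const.mul Real.continuous_arccos)).continuousOn (ε / (G + 1))
      (by positivity)
    have hfp : ∀ x ∈ Ioo 0 L, |f x - p.eval (y x)| ≤ ε / (G + 1) := fun x hx => by
      have h1 := hp (y x) ⟨Real.neg_one_le_cos _, Real.cos_le_one _⟩
      rw [Real.arccos_cos (by have := hx.1; positivity) (by
        rw [div_mul_eq_mul_div, div_le_iff₀ hL]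
        exact mul_le_mul_of_nonneg_left hx.2.le Real.pi_pos.le)] at h1
      have h2 : L / Real.pi * (Real.pi / L * x) = x := by
        field_simp
      rw [h2, abs_sub_comm] at h1
      exact h1.le
    have hsub : ∫ x in Ioo 0 L, g x * ((f x * C 0 x : ℝ) : ℂ)
        = ∫ x in Ioo 0 L, g x * (((f x - p.eval (y x)) * C 0 x : ℝ) : ℂ) := by
      rw [← sub_zero (∫ x in Ioo 0 L, g x * ((f x * C 0 x : ℝ) : ℂ)), ← hpoly p,
        ← integral_sub (hint (fun x => f x * C 0 x) (hf.mul (hCc _))) (hint2 p)]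
      refine integral_congr_ae (Filter.Eventually.of_forall fun x => ?_)
      simp only
      push_cast
      ring
    rw [hsub]
    refine (norm_integral_le_integral_norm _).trans ?_
    calc ∫ x in Ioo 0 L, ‖g x * (((f x - p.eval (y x)) * C 0 x : ℝ) : ℂ)‖
        ≤ ∫ x in Ioo 0 L, ‖g x‖ * (ε / (G + 1)) := by
          refine setIntegral_mono_on
            (hint _ ((hf.sub (p.continuous.comp hyc)).mul (hCc _))).norm
            ((integrable_L2 g).norm.mul_const _) measurableSet_Ioo fun x hx => ?_
          rw [norm_mul, Complex.norm_real, norm_mul]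
          refine mul_le_mul_of_nonneg_left ?_ (norm_nonneg _)
          calc _ ≤ ε / (G + 1) * 1 :=
                mul_le_mul (hfp x hx) (Real.abs_cos_le_one _) (abs_nonneg _) (by positivity)
            _ = _ := mul_one _
      _ = G * (ε / (G + 1)) := by rw [integral_mul_const]
      _ ≤ ε := by
          rw [mul_div_assoc', div_le_iff₀ (by positivity)]
          nlinarith
  have hzero : ∀ᵐ x, x ∈ Ioo 0 L → g x * (C 0 x : ℂ) = 0 := by
    refine isOpen_Ioo.ae_eq_zero_of_integral_contDiff_smul_eq_zero
      (IntegrableOn.locallyIntegrableOn (hint _ (hCc 0))) fun f hf _ hfs => ?_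
    rw [← setIntegral_eq_integral_of_forall_compl_eq_zero (s := Ioo 0 L), ← hcont f hf.continuous]
    · refine integral_congr_ae (Filter.Eventually.of_forall fun x => ?_)
      simp only [Complex.real_smul]
      push_cast
      ring
    · intro x hx
      rw [image_eq_zero_of_notMem_tsupport fun h' => hx (hfs h'), zero_smul]
  rw [← ae_restrict_iff' measurableSet_Ioo] at hzero
  refine Lp.ext ?_
  filter_upwards [hzero, ae_restrict_mem measurableSet_Ioo,
    Lp.coeFn_zero ℂ 2 (volume.restrict (Ioo 0 L))] with x h1 hx h0
  rw [h0, Pi.zero_apply]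
  refine (mul_eq_zero.1 h1).resolve_right ?_
  have hpos : 0 < C 0 x := by
    have hpi := Real.pi_pos
    refine Real.cos_pos_of_mem_Ioo ⟨?_, ?_⟩
    · have : 0 < (2 * ((0 : ℤ) : ℝ) + 1) * Real.pi / (2 * L) * x := by
        have := hx.1
        push_cast
        positivity
      linarith
    · push_cast
      rw [div_mul_eq_mul_div, div_lt_div_iff₀ (by positivity) (by positivity)]
      nlinarith [hx.2]
  exact_mod_cast hpos.ne'

/-- The functions `√(2/L) cos(ω_j x)`, `j ≥ 1`, form a Hilbert basis of `L²(0, L)`. -/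
def cosBasis (hL : 0 < L) : HilbertBasis ℕ ℂ (L2 L) :=
  HilbertBasis.mkOfOrthogonalEqBot (orthonormal_cosL2 hL) (by
    rw [Submodule.eq_bot_iff]
    intro g hg
    refine cosL2_complete hL fun j hj => ?_
    obtain ⟨n, rfl⟩ : ∃ n, j = n + 1 := ⟨j - 1, by omega⟩
    exact (Submodule.mem_orthogonal _ _).1 hg _ (Submodule.subset_span ⟨n, rfl⟩))

@[simp] theorem cosBasis_apply (hL : 0 < L) (n : ℕ) : cosBasis hL n = cosL2 L (n + 1) := by
  rw [cosBasis, HilbertBasis.coe_mkOfOrthogonalEqBot]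

/-- An element of `L²(0, L)` whose primitive is orthogonal to all `e_j` vanishes. -/
theorem eq_zero_of_inner_eigL2_volterra (hL : 0 < L) {g : L2 L}
    (hg : ∀ j, 1 ≤ j → inner ℂ (eigL2 L j) (volterra L g) = 0) : g = 0 :=
  cosL2_complete hL fun j hj => by rw [inner_cosL2_eq hL, hg j hj, mul_zero]

end Basis

/-! ### Calculus up to the boundary of the triangle -/

section Triangle

variable {L : ℝ}

/-- A continuous retraction of the plane onto `triangle L`. -/
def clampTriangle (L : ℝ) (p : ℝ × ℝ) : ℝ × ℝ :=
  (max 0 (min p.1 L), max 0 (min p.2 (max 0 (min p.1 L))))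

theorem continuous_clampTriangle (L : ℝ) : Continuous (clampTriangle L) := by
  unfold clampTriangle
  fun_prop

theorem clampTriangle_mem (hL : 0 < L) (p : ℝ × ℝ) : clampTriangle L p ∈ triangle L := by
  exact ⟨le_max_left _ _, max_le (le_max_left _ _) (min_le_right _ _),
    max_le hL.le (min_le_right _ _)⟩

theorem clampTriangle_eq {p : ℝ × ℝ} (hp : p ∈ triangle L) : clampTriangle L p = p := by
  obtain ⟨h1, h2, h3⟩ := hp
  have h4 : max 0 (min p.1 L) = p.1 := by rw [min_eq_left h3, max_eq_right (h1.trans h2)]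
  rw [clampTriangle, h4, min_eq_left h2, max_eq_right h1]

theorem continuous_comp_clampTriangle (hL : 0 < L) {F : ℝ × ℝ → ℂ}
    (hF : ContinuousOn F (triangle L)) : Continuous fun p => F (clampTriangle L p) :=
  hF.comp_continuous (continuous_clampTriangle L) (clampTriangle_mem hL)

theorem convex_triangle (L : ℝ) : Convex ℝ (triangle L) := by
  rintro p ⟨h1, h2, h3⟩ q ⟨h4, h5, h6⟩ s t hs ht hst
  refine ⟨?_, ?_, ?_⟩
  · simp only [Prod.snd_add, Prod.smul_snd, smul_eq_mul]
    positivity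
  · simp only [Prod.snd_add, Prod.smul_snd, smul_eq_mul, Prod.fst_add, Prod.smul_fst]
    gcongr
  · simp only [smul_eq_mul, Prod.fst_add, Prod.smul_fst]
    calc s * p.1 + t * q.1 ≤ s * L + t * L := by gcongr
      _ = L := by rw [← add_mul, hst, one_mul]

theorem uniqueDiffOn_triangle (hL : 0 < L) : UniqueDiffOn ℝ (triangle L) := by
  refine uniqueDiffOn_convex (convex_triangle L) ⟨(L / 2, L / 4), ?_⟩
  rw [mem_interior]
  refine ⟨{p | 0 < p.2 ∧ p.2 < p.1 ∧ p.1 < L}, fun p hp => ⟨hp.1.le, hp.2.1.le, hp.2.2.le⟩, ?_, ?_⟩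
  · exact (isOpen_lt continuous_const continuous_snd).inter
      ((isOpen_lt continuous_snd continuous_fst).inter (isOpen_lt continuous_fst continuous_const))
  · refine ⟨?_, ?_, ?_⟩ <;> simp only <;> linarith

/-- The partial derivative in direction `v` from within the triangle. -/
def dirDeriv (L : ℝ) (v : ℝ × ℝ) (F : ℝ × ℝ → ℂ) (p : ℝ × ℝ) : ℂ :=
  fderivWithin ℝ F (triangle L) p v

theorem contDiffOn_dirDeriv (hL : 0 < L) (v : ℝ × ℝ) {F : ℝ × ℝ → ℂ} {m n : WithTop ℕ∞}
    (hF : ContDiffOn ℝ n F (triangle L)) (hmn : m + 1 ≤ n) :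
    ContDiffOn ℝ m (dirDeriv L v F) (triangle L) :=
  (hF.fderivWithin (uniqueDiffOn_triangle hL) hmn).clm_apply contDiffOn_const

variable {F : ℝ × ℝ → ℂ}

theorem hasDerivWithinAt_comp_line (hF : ContDiffOn ℝ 1 F (triangle L)) {c : ℝ → ℝ × ℝ}
    {v : ℝ × ℝ} {s : Set ℝ} {x : ℝ} (hc : HasDerivWithinAt c v s x) (hs : MapsTo c s (triangle L))
    (hx : x ∈ s) : HasDerivWithinAt (fun r => F (c r)) (dirDeriv L v F (c x)) s x :=
  ((hF.differentiableOn one_ne_zero _ (hs hx)).hasFDerivWithinAt).comp_hasDerivWithinAt x hc hs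

theorem hasDerivWithinAt_fst (hF : ContDiffOn ℝ 1 F (triangle L)) {x y : ℝ} (hy : 0 ≤ y)
    (hx : x ∈ Icc y L) :
    HasDerivWithinAt (fun s => F (s, y)) (dirDeriv L (1, 0) F (x, y)) (Icc y L) x :=
  hasDerivWithinAt_comp_line hF ((hasDerivWithinAt_id x _).prodMk (hasDerivWithinAt_const x _ y))
    (fun _ hs => ⟨hy, hs.1, hs.2⟩) hx

theorem hasDerivWithinAt_snd (hF : ContDiffOn ℝ 1 F (triangle L)) {x y : ℝ} (hx : x ≤ L)
    (hy : y ∈ Icc 0 x) :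
    HasDerivWithinAt (fun s => F (x, s)) (dirDeriv L (0, 1) F (x, y)) (Icc 0 x) y :=
  hasDerivWithinAt_comp_line hF ((hasDerivWithinAt_const y _ x).prodMk (hasDerivWithinAt_id y _))
    (fun _ hs => ⟨hs.1, hs.2, hx⟩) hy

theorem hasDerivWithinAt_diag (hF : ContDiffOn ℝ 1 F (triangle L)) {x : ℝ} (hx : x ∈ Icc 0 L) :
    HasDerivWithinAt (fun s => F (s, s))
      (dirDeriv L (1, 0) F (x, x) + dirDeriv L (0, 1) F (x, x)) (Icc 0 L) x := by
  have h := hasDerivWithinAt_comp_line hF ((hasDerivWithinAt_id x _).prodMk (hasDerivWithinAt_id x _))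
    (fun _ hs => ⟨hs.1, le_rfl, hs.2⟩) hx
  refine h.congr_deriv ?_
  change fderivWithin ℝ F (triangle L) (x, x) (1, 1) = fderivWithin ℝ F (triangle L) (x, x) (1, 0)
    + fderivWithin ℝ F (triangle L) (x, x) (0, 1)
  rw [← map_add]
  simp

/-- The Volterra integral `∫₀ˣ F(x, y) e(y) dy`. -/
def kerInt (F : ℝ × ℝ → ℂ) (e : ℝ → ℂ) (x : ℝ) : ℂ := ∫ y in (0 : ℝ)..x, F (x, y) * e y

theorem kerInt_congr {F G : ℝ × ℝ → ℂ} {e : ℝ → ℂ} {x : ℝ} (hx : x ∈ Icc 0 L)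
    (h : EqOn F G (triangle L)) : kerInt F e x = kerInt G e x := by
  refine intervalIntegral.integral_congr fun y hy => ?_
  rw [uIcc_of_le hx.1] at hy
  simp only [h (show (x, y) ∈ triangle L from ⟨hy.1, hy.2, hx.2⟩)]

theorem kerInt_clamp {e : ℝ → ℂ} {x : ℝ} (hx : x ∈ Icc 0 L) (F : ℝ × ℝ → ℂ) :
    kerInt (fun p => F (clampTriangle L p)) e x = kerInt F e x :=
  kerInt_congr hx fun p hp => by simp only [clampTriangle_eq hp]

theorem continuousOn_kerInt (hL : 0 < L) {e : ℝ → ℂ} (hF : ContinuousOn F (triangle L))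
    (he : Continuous e) : ContinuousOn (kerInt F e) (Icc 0 L) := by
  have hc := continuous_comp_clampTriangle hL hF
  have h : Continuous (kerInt (fun p => F (clampTriangle L p)) e) :=
    intervalIntegral.continuous_parametric_intervalIntegral_of_continuous
      (f := fun x y => F (clampTriangle L (x, y)) * e y)
      (hc.mul (he.comp continuous_snd)) continuous_id
  exact h.continuousOn.congr fun x hx => (kerInt_clamp hx F).symm

theorem continuousOn_diag (hF : ContinuousOn F (triangle L)) :
    ContinuousOn (fun x => F (x, x)) (Icc 0 L) :=
  hF.comp (by fun_prop) fun _ hx => ⟨hx.1, le_rfl, hx.2⟩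

theorem intervalIntegrable_of_continuousOn_Icc {f : ℝ → ℂ} {x : ℝ} (hf : ContinuousOn f (Icc 0 L))
    (hx : x ∈ Icc 0 L) : IntervalIntegrable f volume 0 x :=
  ContinuousOn.intervalIntegrable_of_Icc hx.1 (hf.mono (Icc_subset_Icc_right hx.2))

/-- Differentiation of a Volterra integral, in integrated form. -/
theorem kerInt_eq_integral (hL : 0 < L) {e : ℝ → ℂ} (hF : ContDiffOn ℝ 1 F (triangle L))
    (he : Continuous e) {x : ℝ} (hx : x ∈ Icc 0 L) :
    kerInt F e x
      = ∫ ξ in (0 : ℝ)..x, (F (ξ, ξ) * e ξ + kerInt (dirDeriv L (1, 0) F) e ξ) := by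
  set F' := dirDeriv L (1, 0) F with hF'
  have hF'c : ContinuousOn F' (triangle L) :=
    (contDiffOn_dirDeriv (m := 0) hL _ hF (by simp)).continuousOn
  -- Composition with the retraction gives a continuous function on the whole plane, so parametric
  -- integrals over moving intervals are continuous and Fubini applies on the full square.
  set G : ℝ × ℝ → ℂ := fun p => F' (clampTriangle L p) with hG
  have hGc : Continuous G := continuous_comp_clampTriangle hL hF'c
  have hGe : Continuous (Function.uncurry fun ξ y => G (ξ, y) * e y) :=
    hGc.mul (he.comp continuous_snd)
  have hdiag : ContinuousOn (fun y => F (y, y) * e y) (Icc 0 L) :=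
    (continuousOn_diag hF.continuousOn).mul he.continuousOn
  -- Here F(x,y) is written as its value on the diagonal plus the integral of its x-derivative from
  -- y to x; exchanging the integrals then gives the formula.
  have h1 : kerInt F e x
      = ∫ y in (0 : ℝ)..x, (F (y, y) * e y + ∫ ξ in y..x, G (ξ, y) * e y) := by
    refine intervalIntegral.integral_congr fun y hy => ?_
    rw [uIcc_of_le hx.1] at hy
    have hsub : ∫ ξ in y..x, G (ξ, y) = F (x, y) - F (y, y) := by
      have hd : ∀ ξ ∈ Icc y x,
          HasDerivWithinAt (fun s => F (s, y)) (G (ξ, y)) (Icc y L) ξ := fun ξ hξ => by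
        have := hasDerivWithinAt_fst hF hy.1 ⟨hξ.1, hξ.2.trans hx.2⟩
        simpa only [hG, clampTriangle_eq (⟨hy.1, hξ.1, hξ.2.trans hx.2⟩ : (ξ, y) ∈ triangle L)]
      refine intervalIntegral.integral_eq_sub_of_hasDerivAt_of_le hy.2
        (fun ξ hξ => ((hd ξ hξ).continuousWithinAt).mono (Icc_subset_Icc_right hx.2))
        (fun ξ hξ => (hd ξ (Ioo_subset_Icc_self hξ)).hasDerivAt
          (Icc_mem_nhds hξ.1 (hξ.2.trans_le hx.2)))
        (Continuous.intervalIntegrable (by fun_prop) _ _)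
    simp only [intervalIntegral.integral_mul_const, hsub]
    ring
  have hc2 : Continuous fun y => ∫ ξ in y..x, G (ξ, y) * e y := by
    simp only [intervalIntegral.integral_symm x]
    refine Continuous.neg ?_
    exact intervalIntegral.continuous_parametric_intervalIntegral_of_continuous
      (f := fun y ξ => G (ξ, y) * e y) (hGe.comp continuous_swap) continuous_id
  have hint : Integrable (Function.uncurry fun ξ y => G (ξ, y) * e y)
      ((volume.restrict (Ioc 0 x)).prod (volume.restrict (Ioc 0 x))) := by
    rw [Measure.prod_restrict]
    exact (hGe.continuousOn.integrableOn_compact (isCompact_Icc.prod isCompact_Icc)).mono_set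
      (prod_mono Ioc_subset_Icc_self Ioc_subset_Icc_self)
  rw [h1, intervalIntegral.integral_add (intervalIntegrable_of_continuousOn_Icc hdiag hx)
    (hc2.intervalIntegrable _ _), integral_triangle_swap hx.1 hint,
    intervalIntegral.integral_add (intervalIntegrable_of_continuousOn_Icc hdiag hx)
    (intervalIntegrable_of_continuousOn_Icc (continuousOn_kerInt hL hF'c he) hx)]
  congr 1
  refine intervalIntegral.integral_congr fun ξ hξ => ?_
  rw [uIcc_of_le hx.1] at hξ
  exact kerInt_clamp ⟨hξ.1, hξ.2.trans hx.2⟩ F'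

end Triangle

/-! ### The backstepping kernel applied to the eigenfunctions -/

section Kernel

variable {L ν α μ : ℝ} {k : ℝ → ℝ → ℂ}

/-- The image `∫₀ˣ k(x, y) e_j(y) dy` of `e_j` under the Volterra operator with kernel `k`. -/
def kerEig (L : ℝ) (k : ℝ → ℝ → ℂ) (j : ℕ) : ℝ → ℂ := kerInt (fun p => k p.1 p.2) (eigfun L j)

/-- The derivative of `kerEig`. -/
def kerEigDeriv (L : ℝ) (k : ℝ → ℝ → ℂ) (j : ℕ) (x : ℝ) : ℂ :=
  k x x * eigfun L j x + kerInt (dirDeriv L (1, 0) fun p => k p.1 p.2) (eigfun L j) x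

theorem continuous_eigfun (L : ℝ) (j : ℕ) : Continuous (eigfun L j) :=
  (contDiff_eigfun (n := 0) L j).continuous

theorem kerEig_eq_integral (hL : 0 < L) (hk : IsKernel L ν α μ k) (j : ℕ) {x : ℝ}
    (hx : x ∈ Icc 0 L) : kerEig L k j x = ∫ ξ in (0 : ℝ)..x, kerEigDeriv L k j ξ :=
  kerInt_eq_integral hL (hk.contDiffOn.of_le one_le_two) (continuous_eigfun L j) hx

theorem IsKernel.contDiffOn_partial (hL : 0 < L) (hk : IsKernel L ν α μ k) (v : ℝ × ℝ) :
    ContDiffOn ℝ 1 (dirDeriv L v fun p => k p.1 p.2) (triangle L) :=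
  contDiffOn_dirDeriv hL v hk.contDiffOn (by norm_num)

theorem continuousOn_kerEigDeriv (hL : 0 < L) (hk : IsKernel L ν α μ k) (j : ℕ) :
    ContinuousOn (kerEigDeriv L k j) (Icc 0 L) :=
  ((continuousOn_diag hk.contDiffOn.continuousOn).mul (continuous_eigfun L j).continuousOn).add
    (continuousOn_kerInt hL (hk.contDiffOn_partial hL _).continuousOn (continuous_eigfun L j))

theorem coeff_ne_zero (hν : 0 < ν) (α : ℝ) : (ν : ℂ) + Complex.I * α ≠ 0 := fun h => by
  have := congrArg Complex.re h
  simp at this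
  exact hν.ne' this

/-- At interior points the slices through the triangle are neighbourhoods, so ordinary iterated
derivatives agree with derivatives from within, which extend continuously to the boundary. -/
theorem IsKernel.second_deriv_eq (hν : 0 < ν) (hk : IsKernel L ν α μ k) (hL : 0 < L)
    {x y : ℝ} (hy : 0 < y) (hyx : y < x) (hx : x < L) :
    dirDeriv L (1, 0) (dirDeriv L (1, 0) fun p => k p.1 p.2) (x, y)
      = dirDeriv L (0, 1) (dirDeriv L (0, 1) fun p => k p.1 p.2) (x, y)
        - (μ : ℂ) / ((ν : ℂ) + Complex.I * α) * k x y := by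
  have hK1 : ContDiffOn ℝ 1 (fun p : ℝ × ℝ => k p.1 p.2) (triangle L) :=
    hk.contDiffOn.of_le one_le_two
  have e1 : iteratedDeriv 2 (fun s => k s y) x
      = dirDeriv L (1, 0) (dirDeriv L (1, 0) fun p => k p.1 p.2) (x, y) := by
    rw [iteratedDeriv_succ, iteratedDeriv_one]
    have h : deriv (fun s => k s y) =ᶠ[nhds x]
        fun s => dirDeriv L (1, 0) (fun p => k p.1 p.2) (s, y) := by
      filter_upwards [Ioo_mem_nhds hyx hx] with s hs
      exact ((hasDerivWithinAt_fst hK1 hy.le ⟨hs.1.le, hs.2.le⟩).hasDerivAt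
        (Icc_mem_nhds hs.1 hs.2)).deriv
    rw [h.deriv_eq]
    exact ((hasDerivWithinAt_fst (hk.contDiffOn_partial hL _) hy.le ⟨hyx.le, hx.le⟩).hasDerivAt
        (Icc_mem_nhds hyx hx)).deriv
  have e2 : iteratedDeriv 2 (fun s => k x s) y
      = dirDeriv L (0, 1) (dirDeriv L (0, 1) fun p => k p.1 p.2) (x, y) := by
    rw [iteratedDeriv_succ, iteratedDeriv_one]
    have h : deriv (fun s => k x s) =ᶠ[nhds y]
        fun s => dirDeriv L (0, 1) (fun p => k p.1 p.2) (x, s) := by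
      filter_upwards [Ioo_mem_nhds hy hyx] with s hs
      exact ((hasDerivWithinAt_snd hK1 hx.le ⟨hs.1.le, hs.2.le⟩).hasDerivAt
        (Icc_mem_nhds hs.1 hs.2)).deriv
    rw [h.deriv_eq]
    exact ((hasDerivWithinAt_snd (hk.contDiffOn_partial hL _) hx.le ⟨hy.le, hyx.le⟩).hasDerivAt
        (Icc_mem_nhds hy hyx)).deriv
  have h := hk.pde x y hy hyx hx
  rw [e1, e2] at h
  have ha := coeff_ne_zero hν α
  field_simp
  linear_combination h

theorem IsKernel.diag_deriv (hk : IsKernel L ν α μ k) (hL : 0 < L) {x : ℝ} (hx : x ∈ Icc 0 L) :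
    dirDeriv L (1, 0) (fun p => k p.1 p.2) (x, x) + dirDeriv L (0, 1) (fun p => k p.1 p.2) (x, x)
      = -(μ : ℂ) / (2 * ((ν : ℂ) + Complex.I * α)) := by
  have h1 := hasDerivWithinAt_diag (hk.contDiffOn.of_le one_le_two) hx
  have h2 : HasDerivWithinAt (fun s : ℝ => k s s) (-(μ : ℂ) / (2 * ((ν : ℂ) + Complex.I * α)))
      (Icc 0 L) x := by
    have h3 : HasDerivAt (fun s : ℝ => -((μ : ℂ) * s) / (2 * ((ν : ℂ) + Complex.I * α)))
        (-(μ : ℂ) / (2 * ((ν : ℂ) + Complex.I * α))) x := by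
      simpa using (((Complex.ofRealCLM.hasDerivAt (x := x)).const_mul (μ : ℂ)).neg.div_const
        (2 * ((ν : ℂ) + Complex.I * α)))
    exact h3.hasDerivWithinAt.congr (fun s hs => hk.diagonal s hs) (hk.diagonal x hx)
  exact (uniqueDiffOn_Icc hL x hx).eq_deriv _ h1 h2

/-- The kernel equation trades k_xx for k_yy, and two integrations by parts in y move the
derivatives onto e_j. The terms at y = 0 vanish because e_j(0) = 0 and k(x,0) = 0; those at y = ξ
remain. -/
theorem IsKernel.kerInt_second_deriv (hν : 0 < ν) (hL : 0 < L) (hk : IsKernel L ν α μ k) (j : ℕ)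
    {ξ : ℝ} (hξ : ξ ∈ Ioo 0 L) :
    kerInt (dirDeriv L (1, 0) (dirDeriv L (1, 0) fun p => k p.1 p.2)) (eigfun L j) ξ
      = dirDeriv L (0, 1) (fun p => k p.1 p.2) (ξ, ξ) * eigfun L j ξ
        - k ξ ξ * (freq L j * cosfun L j ξ)
        - ((eigval L j : ℂ) + μ / ((ν : ℂ) + Complex.I * α)) * kerEig L k j ξ := by
  have hK1 : ContDiffOn ℝ 1 (fun p : ℝ × ℝ => k p.1 p.2) (triangle L) :=
    hk.contDiffOn.of_le one_le_two
  set Ky := dirDeriv L (0, 1) fun p => k p.1 p.2 with hKy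
  have hKy1 : ContDiffOn ℝ 1 Ky (triangle L) := hk.contDiffOn_partial hL _
  have hKyy : ContinuousOn (dirDeriv L (0, 1) Ky) (triangle L) :=
    (contDiffOn_dirDeriv (m := 0) hL _ hKy1 (by simp)).continuousOn
  have hmaps : MapsTo (fun y => (ξ, y)) (Icc 0 ξ) (triangle L) :=
    fun y hy => ⟨hy.1, hy.2, hξ.2.le⟩
  have hd : ∀ y ∈ Icc 0 ξ, HasDerivWithinAt
      (fun y => Ky (ξ, y) * eigfun L j y - k ξ y * (freq L j * cosfun L j y))
      (dirDeriv L (0, 1) Ky (ξ, y) * eigfun L j y + eigval L j * (k ξ y * eigfun L j y))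
      (Icc 0 ξ) y := fun y hy => by
    have h1 := (hasDerivWithinAt_snd hKy1 hξ.2.le hy).mul
      (hasDerivAt_eigfun L j y).hasDerivWithinAt
    have h2 := (hasDerivWithinAt_snd hK1 hξ.2.le hy).mul
      ((hasDerivAt_cosfun L j y).const_mul (freq L j : ℂ)).hasDerivWithinAt
    refine (h1.sub h2).congr_deriv ?_
    rw [← freq_sq]
    push_cast
    ring
  have hKyyc : ContinuousOn (fun y => dirDeriv L (0, 1) Ky (ξ, y) * eigfun L j y) (Icc 0 ξ) :=
    (hKyy.comp (by fun_prop) hmaps).mul (continuous_eigfun L j).continuousOn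
  have hKc : ContinuousOn (fun y => k ξ y * eigfun L j y) (Icc 0 ξ) :=
    (hK1.continuousOn.comp (by fun_prop) hmaps).mul (continuous_eigfun L j).continuousOn
  have hi1 := hKyyc.intervalIntegrable_of_Icc (μ := volume) hξ.1.le
  have hi2 := hKc.intervalIntegrable_of_Icc (μ := volume) hξ.1.le
  have hftc := intervalIntegral.integral_eq_sub_of_hasDerivAt_of_le hξ.1.le
    (fun y hy => (hd y hy).continuousWithinAt)
    (fun y hy => (hd y (Ioo_subset_Icc_self hy)).hasDerivAt (Icc_mem_nhds hy.1 hy.2))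
    (hi1.add (hi2.const_mul _))
  rw [eigfun_zero, hk.bottom ξ ⟨hξ.1.le, hξ.2.le⟩, intervalIntegral.integral_add hi1
    (hi2.const_mul _), intervalIntegral.integral_const_mul] at hftc
  have hpde : kerInt (dirDeriv L (1, 0) (dirDeriv L (1, 0) fun p => k p.1 p.2)) (eigfun L j) ξ
      = ∫ y in (0 : ℝ)..ξ, (dirDeriv L (0, 1) Ky (ξ, y) * eigfun L j y
        - (μ : ℂ) / ((ν : ℂ) + Complex.I * α) * (k ξ y * eigfun L j y)) := by
    rw [kerInt, intervalIntegral.integral_of_le hξ.1.le, intervalIntegral.integral_of_le hξ.1.le,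
      integral_Ioc_eq_integral_Ioo, integral_Ioc_eq_integral_Ioo]
    refine setIntegral_congr_fun measurableSet_Ioo fun y hy => ?_
    simp only [hk.second_deriv_eq hν hL hy.1 hy.2 hξ.2]
    ring
  have hker : kerEig L k j ξ = ∫ y in (0 : ℝ)..ξ, k ξ y * eigfun L j y := rfl
  rw [hpde, intervalIntegral.integral_sub hi1 (hi2.const_mul _),
    intervalIntegral.integral_const_mul, ← hker]
  rw [← hker] at hftc
  linear_combination hftc

/-- The second derivative of `kerEig`, in integrated form. -/
theorem kerEigDeriv_eq_integral (hν : 0 < ν) (hL : 0 < L) (hk : IsKernel L ν α μ k) (j : ℕ)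
    {x : ℝ} (hx : x ∈ Icc 0 L) :
    kerEigDeriv L k j x = ∫ ξ in (0 : ℝ)..x,
      (-(μ : ℂ) / ((ν : ℂ) + Complex.I * α) * eigfun L j ξ
        - ((eigval L j : ℂ) + μ / ((ν : ℂ) + Complex.I * α)) * kerEig L k j ξ) := by
  have ha := coeff_ne_zero hν α
  have hK1 : ContDiffOn ℝ 1 (fun p : ℝ × ℝ => k p.1 p.2) (triangle L) :=
    hk.contDiffOn.of_le one_le_two
  set Kx := dirDeriv L (1, 0) fun p => k p.1 p.2 with hKx
  set Ky := dirDeriv L (0, 1) fun p => k p.1 p.2 with hKy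
  have hKx1 : ContDiffOn ℝ 1 Kx (triangle L) := hk.contDiffOn_partial hL _
  have hKy1 : ContDiffOn ℝ 1 Ky (triangle L) := hk.contDiffOn_partial hL _
  have hKxx : ContinuousOn (dirDeriv L (1, 0) Kx) (triangle L) :=
    (contDiffOn_dirDeriv (m := 0) hL _ hKx1 (by simp)).continuousOn
  have hec := continuous_eigfun L j
  have hcc : Continuous (cosfun L j) := (contDiff_cosfun (n := 0) L j).continuous
  have hd : ∀ ξ ∈ Icc 0 L, HasDerivWithinAt (fun ξ => k ξ ξ * eigfun L j ξ)
      ((Kx (ξ, ξ) + Ky (ξ, ξ)) * eigfun L j ξ + k ξ ξ * (freq L j * cosfun L j ξ)) (Icc 0 L) ξ :=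
    fun ξ hξ => (hasDerivWithinAt_diag hK1 hξ).mul (hasDerivAt_eigfun L j ξ).hasDerivWithinAt
  have hi1 : IntervalIntegrable (fun ξ => (Kx (ξ, ξ) + Ky (ξ, ξ)) * eigfun L j ξ
      + k ξ ξ * (freq L j * cosfun L j ξ)) volume 0 x := by
    refine intervalIntegrable_of_continuousOn_Icc (L := L) ?_ hx
    exact (((continuousOn_diag hKx1.continuousOn).add (continuousOn_diag hKy1.continuousOn)).mul
      hec.continuousOn).add ((continuousOn_diag hK1.continuousOn).mul
      (continuous_const.mul hcc).continuousOn)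
  have hi2 : IntervalIntegrable (fun ξ => Kx (ξ, ξ) * eigfun L j ξ
      + kerInt (dirDeriv L (1, 0) Kx) (eigfun L j) ξ) volume 0 x := by
    refine intervalIntegrable_of_continuousOn_Icc (L := L) ?_ hx
    exact ((continuousOn_diag hKx1.continuousOn).mul hec.continuousOn).add
      (continuousOn_kerInt hL hKxx hec)
  have hftc := intervalIntegral.integral_eq_sub_of_hasDerivAt_of_le hx.1
    (fun ξ hξ => ((hd ξ ⟨hξ.1, hξ.2.trans hx.2⟩).continuousWithinAt).mono
      (Icc_subset_Icc_right hx.2))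
    (fun ξ hξ => (hd ξ ⟨hξ.1.le, hξ.2.le.trans hx.2⟩).hasDerivAt
      (Icc_mem_nhds hξ.1 (hξ.2.trans_le hx.2))) hi1
  rw [eigfun_zero, mul_zero, sub_zero] at hftc
  rw [kerEigDeriv, ← hftc, ← hKx, kerInt_eq_integral hL hKx1 hec hx,
    ← intervalIntegral.integral_add hi1 hi2, intervalIntegral.integral_of_le hx.1,
    intervalIntegral.integral_of_le hx.1, integral_Ioc_eq_integral_Ioo,
    integral_Ioc_eq_integral_Ioo]
  refine setIntegral_congr_fun measurableSet_Ioo fun ξ hξ => ?_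
  have hξ' : ξ ∈ Ioo 0 L := ⟨hξ.1, hξ.2.trans_le hx.2⟩
  have h1 := hk.diag_deriv hL (Ioo_subset_Icc_self hξ')
  have h2 := hk.kerInt_second_deriv hν hL j hξ'
  rw [← hKx, ← hKy] at h1 h2
  -- The sum k_x + k_y on the diagonal occurs twice: once from differentiating k(ξ,ξ), and once from
  -- the moving endpoint together with the integration by parts. This explains the 2 in the diagonal
  -- condition. The terms with e_j' cancel.
  have h3 : -(μ : ℂ) / ((ν : ℂ) + Complex.I * α) = 2 * (-(μ : ℂ) / (2 * ((ν : ℂ) + Complex.I * α))) := by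
    field_simp
  simp only [h2]
  rw [h3, ← h1]
  ring

/-- For y < L the slice [y, L] is nondegenerate and the one-sided derivative is unambiguous; the
degenerate slice y = L is a null set. -/
theorem integral_derivWithin_mul (hL : 0 < L) (hk : IsKernel L ν α μ k) (e : ℝ → ℂ) :
    ∫ y in (0 : ℝ)..L, derivWithin (fun x => k x y) (Icc y L) L * e y
      = kerInt (dirDeriv L (1, 0) fun p => k p.1 p.2) e L := by
  rw [kerInt, intervalIntegral_eq_Ioo hL.le, intervalIntegral_eq_Ioo hL.le]
  refine setIntegral_congr_fun measurableSet_Ioo fun y hy => ?_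
  have h1 := hasDerivWithinAt_fst (hk.contDiffOn.of_le one_le_two) hy.1.le
    (right_mem_Icc.2 hy.2.le)
  simp only [h1.derivWithin (uniqueDiffOn_Icc hy.2 L (right_mem_Icc.2 hy.2.le))]

/-- Volterra integrals of linear combinations of the `e_j`. -/
theorem kerInt_sum (F : ℝ × ℝ → ℂ) (hF : ContinuousOn F (triangle L)) (s : Finset ℕ) (c : ℕ → ℂ)
    {x : ℝ} (hx : x ∈ Icc 0 L) :
    kerInt F (fun y => ∑ j ∈ s, c j * eigfun L j y) x = ∑ j ∈ s, c j * kerInt F (eigfun L j) x := by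
  have hi : ∀ j, IntervalIntegrable (fun y => c j * (F (x, y) * eigfun L j y)) volume 0 x :=
    fun j => ContinuousOn.intervalIntegrable_of_Icc hx.1 (continuousOn_const.mul
      ((hF.comp (by fun_prop) fun y hy => ⟨hy.1, hy.2, hx.2⟩).mul (continuous_eigfun L j).continuousOn))
  simp only [kerInt, ← intervalIntegral.integral_const_mul]
  rw [← intervalIntegral.integral_finsetSum fun j _ => hi j]
  refine intervalIntegral.integral_congr fun y _ => ?_
  simp only [Finset.mul_sum]
  exact Finset.sum_congr rfl fun j _ => by ring

/-- `kerEigDeriv` as an element of `L²(0, L)`. -/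
def kerEigDerivL2 (hL : 0 < L) (hk : IsKernel L ν α μ k) (j : ℕ) : L2 L :=
  (memLp_of_continuousOn (continuousOn_kerEigDeriv hL hk j)).toLp _

theorem kerEigDerivL2_ae (hL : 0 < L) (hk : IsKernel L ν α μ k) (j : ℕ) :
    kerEigDerivL2 hL hk j =ᵐ[volume.restrict (Ioo 0 L)] kerEigDeriv L k j :=
  MemLp.coeFn_toLp _

theorem volterra_kerEigDerivL2_ae (hL : 0 < L) (hk : IsKernel L ν α μ k) (j : ℕ) :
    volterra L (kerEigDerivL2 hL hk j) =ᵐ[volume.restrict (Ioo 0 L)] kerEig L k j := by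
  filter_upwards [volterra_ae (kerEigDerivL2 hL hk j), ae_restrict_mem measurableSet_Ioo] with x h1 hx
  rw [h1, kerEig_eq_integral hL hk j (Ioo_subset_Icc_self hx), intervalIntegral_eq_Ioo hx.1.le,
    intervalIntegral_eq_Ioo hx.1.le]
  exact integral_congr_ae
    (ae_restrict_of_ae_restrict_of_subset (Ioo_subset_Ioo_right hx.2.le) (kerEigDerivL2_ae hL hk j))

/-- The weak form of the boundary value problem satisfied by `κ_j(x) = ∫₀ˣ k(x, y) e_j(y) dy`. -/
theorem kerEig_weak (hν : 0 < ν) (hL : 0 < L) (hk : IsKernel L ν α μ k) (j : ℕ) {φ : ℝ → ℂ}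
    (hφ : ContDiff ℝ 1 φ) :
    ((ν : ℂ) + Complex.I * α) * (kerEigDeriv L k j L * φ L
        - ∫ x in Ioo 0 L, kerEigDerivL2 hL hk j x * deriv φ x)
      = -(μ : ℂ) * (∫ x in Ioo 0 L, eigL2 L j x * φ x)
        - (((ν : ℂ) + Complex.I * α) * eigval L j + μ)
          * ∫ x in Ioo 0 L, volterra L (kerEigDerivL2 hL hk j) x * φ x := by
  have ha := coeff_ne_zero hν α
  set a : ℂ := (ν : ℂ) + Complex.I * α with ha'
  -- This is κ_j'' as an element of L². Since κ_j'(0) = 0, κ_j' is the primitive of g and the weak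
  -- form is one integration by parts.
  set g : L2 L := (-(μ : ℂ) / a) • eigL2 L j
    - ((eigval L j : ℂ) + μ / a) • volterra L (kerEigDerivL2 hL hk j) with hg
  have hgae : g =ᵐ[volume.restrict (Ioo 0 L)] fun ξ => -(μ : ℂ) / a * eigfun L j ξ
        - ((eigval L j : ℂ) + μ / a) * kerEig L k j ξ := by
    filter_upwards [Lp.coeFn_sub ((-(μ : ℂ) / a) • eigL2 L j)
      (((eigval L j : ℂ) + μ / a) • volterra L (kerEigDerivL2 hL hk j)),
      Lp.coeFn_smul (-(μ : ℂ) / a) (eigL2 L j),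
      Lp.coeFn_smul ((eigval L j : ℂ) + μ / a) (volterra L (kerEigDerivL2 hL hk j)),
      eigL2_ae L j, volterra_kerEigDerivL2_ae hL hk j] with x h1 h2 h3 h4 h5
    rw [h1, Pi.sub_apply, h2, h3, Pi.smul_apply, Pi.smul_apply, h4, h5, smul_eq_mul, smul_eq_mul]
  have hgint : ∀ x ∈ Icc 0 L, kerEigDeriv L k j x = ∫ y in (0 : ℝ)..x, g y := fun x hx => by
    rw [kerEigDeriv_eq_integral hν hL hk j hx, intervalIntegral_eq_Ioo hx.1,
      intervalIntegral_eq_Ioo hx.1]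
    exact (integral_congr_ae
      (ae_restrict_of_ae_restrict_of_subset (Ioo_subset_Ioo_right hx.2) hgae)).symm
  have hvg : kerEigDerivL2 hL hk j = volterra L g := by
    refine Lp.ext ?_
    filter_upwards [kerEigDerivL2_ae hL hk j, volterra_ae g, ae_restrict_mem measurableSet_Ioo]
      with x h1 h2 hx
    rw [h1, h2, hgint x (Ioo_subset_Icc_self hx)]
  have hibp := integral_volterra_mul_deriv hL.le g hφ
  have hgφ : ∫ x in Ioo 0 L, g x * φ x
      = -(μ : ℂ) / a * (∫ x in Ioo 0 L, eigL2 L j x * φ x)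
        - ((eigval L j : ℂ) + μ / a)
          * ∫ x in Ioo 0 L, volterra L (kerEigDerivL2 hL hk j) x * φ x := by
    obtain ⟨A, hA⟩ := exists_pairing L hφ.continuous
    rw [← hA, ← hA, ← hA, hg]
    simp
  rw [← hvg] at hibp
  rw [hibp, hgint L (right_mem_Icc.2 hL.le), intervalIntegral_eq_Ioo hL.le, hgφ]
  field_simp
  ring

end Kernel

/-! ### Conjugation of the closed loop to the target system -/

section ClosedLoop

variable {L ν α γ μ : ℝ} {k : ℝ → ℝ → ℂ} {N : ℕ} {T : L2 L ≃L[ℂ] L2 L}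

theorem proj_apply (L : ℝ) (N : ℕ) (u : L2 L) :
    proj L N u = ∑ j ∈ Finset.Icc 1 N, inner ℂ (eigL2 L j) u • eigL2 L j := by
  simp [proj]

theorem inner_proj (hL : 0 < L) {i : ℕ} (hi : i ∈ Finset.Icc 1 N) (u : L2 L) :
    inner ℂ (eigL2 L i) (proj L N u) = inner ℂ (eigL2 L i) u := by
  rw [proj_apply, inner_sum, Finset.sum_eq_single i]
  · rw [inner_smul_right, inner_eigL2_eigL2 hL (Finset.mem_Icc.1 hi).1 (Finset.mem_Icc.1 hi).1]
    simp
  · intro j hj hji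
    rw [inner_smul_right, inner_eigL2_eigL2 hL (Finset.mem_Icc.1 hi).1 (Finset.mem_Icc.1 hj).1,
      if_neg hji.symm, mul_zero]
  · exact fun h => absurd hi h

theorem proj_proj (hL : 0 < L) {J : ℕ} (hJ : N ≤ J) (u : L2 L) :
    proj L N (proj L J u) = proj L N u := by
  rw [proj_apply, proj_apply L N u]
  refine Finset.sum_congr rfl fun j hj => ?_
  rw [inner_proj hL (Finset.Icc_subset_Icc_right hJ hj)]

/-- T_N is a finite-rank perturbation of the identity. Its range vectors κ_j are recorded as
primitives so that the formula can be differentiated. -/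
theorem IsAdmissible.apply_eq (hL : 0 < L) (hk : IsKernel L ν α μ k) (hT : IsAdmissible L k μ N T)
    (w : L2 L) : T w = w + ∑ j ∈ Finset.Icc 1 N,
      inner ℂ (eigL2 L j) w • volterra L (kerEigDerivL2 hL hk j) := by
  refine Lp.ext ?_
  have h1 : ∀ᵐ x ∂volume.restrict (Ioo 0 L), ∀ j ∈ Finset.Icc 1 N,
      (inner ℂ (eigL2 L j) w • volterra L (kerEigDerivL2 hL hk j) : L2 L) x
        = inner ℂ (eigL2 L j) w * kerEig L k j x := by
    rw [Filter.eventually_all_finset]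
    intro j _
    filter_upwards [Lp.coeFn_smul (inner ℂ (eigL2 L j) w) (volterra L (kerEigDerivL2 hL hk j)),
      volterra_kerEigDerivL2_ae hL hk j] with x h2 h3
    rw [h2, Pi.smul_apply, h3, smul_eq_mul]
  filter_upwards [hT.apply_ae w, h1, ae_restrict_mem measurableSet_Ioo,
    Lp.coeFn_add w (∑ j ∈ Finset.Icc 1 N,
      inner ℂ (eigL2 L j) w • volterra L (kerEigDerivL2 hL hk j)),
    Lp.coeFn_finsetSum (Finset.Icc 1 N)
      (fun j => inner ℂ (eigL2 L j) w • volterra L (kerEigDerivL2 hL hk j))] with x h2 h3 hx h4 h5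
  rw [h2, h4, Pi.add_apply, h5, Finset.sum_apply, Finset.sum_congr rfl h3]
  congr 1
  exact kerInt_sum (fun p => k p.1 p.2) hk.contDiffOn.continuousOn _ _ (Ioo_subset_Icc_self hx)

/-- With w = T_N⁻¹ r, the vector z = w - r lies in the span of the κ_j and has the same first N
modes as w, which forces T_N z = 0. Injectivity gives z = 0, so these modes vanish. -/
theorem IsAdmissible.inner_symm_eq_zero (hL : 0 < L) (hk : IsKernel L ν α μ k)
    (hT : IsAdmissible L k μ N T) {r : L2 L}
    (hr : ∀ i ∈ Finset.Icc 1 N, inner ℂ (eigL2 L i) r = 0) {i : ℕ} (hi : i ∈ Finset.Icc 1 N) :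
    inner ℂ (eigL2 L i) (T.symm r) = 0 := by
  set w := T.symm r with hw
  set z : L2 L := -∑ j ∈ Finset.Icc 1 N,
      inner ℂ (eigL2 L j) w • volterra L (kerEigDerivL2 hL hk j) with hz
  have h1 : r = w - z := by
    rw [hz, sub_neg_eq_add, ← hT.apply_eq hL hk w, hw, T.apply_symm_apply]
  have h2 : ∀ j ∈ Finset.Icc 1 N, inner ℂ (eigL2 L j) z = inner ℂ (eigL2 L j) w := fun j hj => by
    have := hr j hj
    rw [h1, inner_sub_right, sub_eq_zero] at this
    exact this.symm
  have h3 : T z = 0 := by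
    rw [hT.apply_eq hL hk z, Finset.sum_congr rfl fun j hj => by rw [h2 j hj]]
    exact neg_add_cancel _
  have h4 : z = 0 := by simpa using h3
  rw [← h2 i hi, h4, inner_zero_right]

/-- The operator Γ_N recovers the first N modes of the target state T_N⁻¹ u from P_N u alone: the
part u - P_N u contributes nothing to them. -/
theorem IsAdmissible.inner_gammaOp (hL : 0 < L) (hk : IsKernel L ν α μ k)
    (hT : IsAdmissible L k μ N T) (u : L2 L) {i : ℕ} (hi : i ∈ Finset.Icc 1 N) :
    inner ℂ (eigL2 L i) (gammaOp N T (proj L N u)) = inner ℂ (eigL2 L i) (T.symm u) := by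
  have h1 : gammaOp N T (proj L N u)
      = proj L N u - proj L N (proj L N u - T.symm (proj L N u)) := rfl
  have h2 := hT.inner_symm_eq_zero hL hk (r := u - proj L N u)
    (fun j hj => by rw [inner_sub_right, inner_proj hL hj, sub_self]) hi
  rw [map_sub, inner_sub_right, sub_eq_zero] at h2
  rw [h1, inner_sub_right, inner_proj hL hi (proj L N u - _), inner_sub_right, h2]
  ring

/-- The feedback `u ↦ b(P_N u)` as a bounded functional on `L²(0, L)`. -/
def feedbackCLM (k : ℝ → ℝ → ℂ) (N : ℕ) (T : L2 L ≃L[ℂ] L2 L) : L2 L →L[ℂ] ℂ :=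
  ∑ i ∈ Finset.Icc 1 N, kerEigDeriv L k i L •
    (innerSL ℂ (eigL2 L i)).comp (T.symm : L2 L →L[ℂ] L2 L)

theorem feedbackCLM_apply (k : ℝ → ℝ → ℂ) (N : ℕ) (T : L2 L ≃L[ℂ] L2 L) (u : L2 L) :
    feedbackCLM k N T u
      = ∑ i ∈ Finset.Icc 1 N, kerEigDeriv L k i L * inner ℂ (eigL2 L i) (T.symm u) := by
  simp [feedbackCLM]

/-- The two terms of the feedback, the integral of k_x(L,·) and the boundary value with factor
k(L,L), are those of κ_i'(L). -/
theorem IsAdmissible.feedback_eq (hL : 0 < L) (hk : IsKernel L ν α μ k)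
    (hT : IsAdmissible L k μ N T) (u : L2 L) :
    feedback L ν α μ k N T (proj L N u) = feedbackCLM k N T u := by
  rw [feedback, integral_derivWithin_mul hL hk, feedbackCLM_apply]
  have h := kerInt_sum (dirDeriv L (1, 0) fun p => k p.1 p.2)
    (hk.contDiffOn_partial hL _).continuousOn (Finset.Icc 1 N)
    (fun j => inner ℂ (eigL2 L j) (gammaOp N T (proj L N u))) (right_mem_Icc.2 hL.le)
  have h' : kerInt (dirDeriv L (1, 0) fun p => k p.1 p.2)
      (projFun L N (gammaOp N T (proj L N u))) L = _ := h
  rw [h', projFun, Finset.mul_sum, ← Finset.sum_sub_distrib]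
  refine Finset.sum_congr rfl fun i hi => ?_
  rw [hT.inner_gammaOp hL hk u hi, kerEigDeriv, hk.diagonal L (right_mem_Icc.2 hL.le)]
  ring

/-- This closes the equations for the first J modes in the uniqueness proof. -/
theorem IsAdmissible.feedbackCLM_proj (hL : 0 < L) (hk : IsKernel L ν α μ k)
    (hT : IsAdmissible L k μ N T) {J : ℕ} (hJ : N ≤ J) (u : L2 L) :
    feedbackCLM k N T (proj L J u) = feedbackCLM k N T u := by
  rw [← hT.feedback_eq hL hk, ← hT.feedback_eq hL hk, proj_proj hL hJ]

/-- The operator `T_N` acting on derivatives: `volterra (R g) = T_N (volterra g)`. -/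
def derivTransform (hL : 0 < L) (hk : IsKernel L ν α μ k) (N : ℕ) : L2 L →L[ℂ] L2 L :=
  ContinuousLinearMap.id ℂ (L2 L) + ∑ j ∈ Finset.Icc 1 N,
    ((innerSL ℂ (eigL2 L j)).comp (volterra L)).smulRight (kerEigDerivL2 hL hk j)

theorem derivTransform_apply (hL : 0 < L) (hk : IsKernel L ν α μ k) (N : ℕ) (g : L2 L) :
    derivTransform hL hk N g = g + ∑ j ∈ Finset.Icc 1 N,
      inner ℂ (eigL2 L j) (volterra L g) • kerEigDerivL2 hL hk j := by
  simp [derivTransform]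

theorem IsAdmissible.volterra_derivTransform (hL : 0 < L) (hk : IsKernel L ν α μ k)
    (hT : IsAdmissible L k μ N T) (g : L2 L) :
    volterra L (derivTransform hL hk N g) = T (volterra L g) := by
  rw [derivTransform_apply, hT.apply_eq hL hk, map_add, map_sum]
  simp

/-- The inverse of `derivTransform`. -/
def derivTransformInv (hL : 0 < L) (hk : IsKernel L ν α μ k) (N : ℕ) (T : L2 L ≃L[ℂ] L2 L) :
    L2 L →L[ℂ] L2 L :=
  ContinuousLinearMap.id ℂ (L2 L) - ∑ j ∈ Finset.Icc 1 N,
    ((innerSL ℂ (eigL2 L j)).comp ((T.symm : L2 L →L[ℂ] L2 L).comp (volterra L))).smulRight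
      (kerEigDerivL2 hL hk j)

theorem derivTransformInv_apply (hL : 0 < L) (hk : IsKernel L ν α μ k) (N : ℕ)
    (T : L2 L ≃L[ℂ] L2 L) (h : L2 L) :
    derivTransformInv hL hk N T h = h - ∑ j ∈ Finset.Icc 1 N,
      inner ℂ (eigL2 L j) (T.symm (volterra L h)) • kerEigDerivL2 hL hk j := by
  simp [derivTransformInv]

/-- Differentiating T_N⁻¹ u = u - ∑ (e_j, T_N⁻¹ u) κ_j yields the inverse. Only this side is needed,
to match the initial datum. -/
theorem IsAdmissible.derivTransform_inv (hL : 0 < L) (hk : IsKernel L ν α μ k)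
    (hT : IsAdmissible L k μ N T) (h : L2 L) :
    derivTransform hL hk N (derivTransformInv hL hk N T h) = h := by
  have h1 : volterra L (derivTransformInv hL hk N T h) = T.symm (volterra L h) := by
    have h2 := hT.apply_eq hL hk (T.symm (volterra L h))
    rw [T.apply_symm_apply] at h2
    rw [derivTransformInv_apply, map_sub, map_sum]
    simp only [map_smul]
    exact sub_eq_of_eq_add h2
  rw [derivTransform_apply, h1, derivTransformInv_apply, sub_add_cancel]

/-- The eigenvalues of the target system `w_t = (ν + iα) w_xx + γ w - μ P_N w`. -/
def targetRate (L ν α γ μ : ℝ) (N n : ℕ) : ℂ :=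
  γ - ((ν : ℂ) + Complex.I * α) * eigval L (n + 1) - if n + 1 ≤ N then (μ : ℂ) else 0

/-- The functionals in the weak formulation for a test function `φ`, and their values on the
transformed basis. -/
theorem IsAdmissible.exists_functionals (hL : 0 < L) (hν : 0 < ν) (hk : IsKernel L ν α μ k)
    (hT : IsAdmissible L k μ N T) {φ : ℝ → ℂ} (hφ : ContDiff ℝ 1 φ) (hφ0 : φ 0 = 0) :
    ∃ A B : L2 L →L[ℂ] ℂ, (∀ h, A h = ∫ x in Ioo 0 L, volterra L h x * φ x) ∧
      (∀ h, B h = ((ν : ℂ) + Complex.I * α) *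
            (feedback L ν α μ k N T (proj L N (volterra L h)) * φ L
              - ∫ x in Ioo 0 L, h x * deriv φ x)
          + (γ : ℂ) * ∫ x in Ioo 0 L, volterra L h x * φ x) ∧
      ∀ n, B (derivTransform hL hk N (cosBasis hL n))
        = targetRate L ν α γ μ N n * A (derivTransform hL hk N (cosBasis hL n)) := by
  obtain ⟨P, hP⟩ := exists_pairing L hφ.continuous
  obtain ⟨P', hP'⟩ := exists_pairing L (hφ.continuous_deriv le_rfl)
  set a : ℂ := (ν : ℂ) + Complex.I * α with ha
  set A : L2 L →L[ℂ] ℂ := P.comp (volterra L) with hA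
  set B : L2 L →L[ℂ] ℂ := a • (φ L • (feedbackCLM k N T).comp (volterra L) - P') + (γ : ℂ) • A with hB
  have hBapp : ∀ h, B h = a * (feedbackCLM k N T (volterra L h) * φ L - P' h) + γ * P (volterra L h) :=
    fun h => by
      change a * (φ L * feedbackCLM k N T (volterra L h) - P' h) + γ * P (volterra L h) = _
      ring
  refine ⟨A, B, fun h => hP _, fun h => ?_, fun n => ?_⟩
  · rw [hBapp, hP, hP', hT.feedback_eq hL hk]
  set j := n + 1 with hj
  have hω : (freq L j : ℂ) ≠ 0 := by exact_mod_cast (freq_pos hL (Nat.le_add_left 1 n)).ne'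
  set R := derivTransform hL hk N with hR
  -- This multiple of the basis vector is e_j', whose primitive is exactly e_j; linearity and ω_j ≠
  -- 0 remove the factor.
  set c : L2 L := (freq L j : ℂ) • cosL2 L j with hc
  have hvc : volterra L c = eigL2 L j := by rw [hc, map_smul, smul_volterra_cosL2]
  suffices h : B (R c) = targetRate L ν α γ μ N n * A (R c) by
    rw [hc, map_smul, map_smul, map_smul, smul_eq_mul, smul_eq_mul, mul_left_comm] at h
    rw [cosBasis_apply]
    exact mul_left_cancel₀ hω h
  have hfb : feedbackCLM k N T (volterra L (R c))
      = if j ≤ N then kerEigDeriv L k j L else 0 := by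
    rw [hR, hT.volterra_derivTransform hL hk, feedbackCLM_apply, hvc, T.symm_apply_apply]
    rw [Finset.sum_congr rfl fun i hi => by
      rw [inner_eigL2_eigL2 hL (Finset.mem_Icc.1 hi).1 (Nat.le_add_left 1 n)]]
    simp [hj]
  have hRc : R c = c + if j ≤ N then kerEigDerivL2 hL hk j else 0 := by
    rw [hR, derivTransform_apply, hvc]
    rw [Finset.sum_congr rfl fun i hi => by
      rw [inner_eigL2_eigL2 hL (Finset.mem_Icc.1 hi).1 (Nat.le_add_left 1 n)]]
    simp [hj]
  -- Both boundary terms vanish: the cosine at L, and φ at 0.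
  have hP'c : P' c = eigval L j * P (eigL2 L j) := by
    have hcc : Continuous (cosfun L j) := (contDiff_cosfun (n := 0) L j).continuous
    have h1 := intervalIntegral.integral_mul_deriv_eq_deriv_mul (a := 0) (b := L)
      (fun x _ => hasDerivAt_cosfun L j x)
      (fun x _ => (hφ.differentiable one_ne_zero x).hasDerivAt)
      ((continuous_const.mul (continuous_eigfun L j)).intervalIntegrable _ _)
      ((hφ.continuous_deriv le_rfl).intervalIntegrable _ _)
    have h2 : P' (cosL2 L j) = ∫ x in (0 : ℝ)..L, cosfun L j x * deriv φ x := by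
      rw [hP', intervalIntegral_eq_Ioo hL.le]
      refine integral_congr_ae ?_
      filter_upwards [cosL2_ae L j] with x hx
      rw [hx]
    have h3 : P (eigL2 L j) = ∫ x in (0 : ℝ)..L, eigfun L j x * φ x := by
      rw [hP, intervalIntegral_eq_Ioo hL.le]
      refine integral_congr_ae ?_
      filter_upwards [eigL2_ae L j] with x hx
      rw [hx]
    simp only [mul_assoc, intervalIntegral.integral_const_mul] at h1
    rw [cosfun_self hL, hφ0, ← h3, ← h2] at h1
    rw [hc, map_smul, smul_eq_mul, h1, ← freq_sq]
    push_cast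
    ring
  have hAB : A (R c) = P (volterra L (R c)) := rfl
  rw [hBapp, hAB, hfb, hRc, map_add, map_add, map_add, hvc, hP'c, targetRate, ← hj, ← ha]
  -- For j ≤ N the weak equation of κ_j supplies -μ e_j - μ κ_j, which is the shift -μ acting on T_N
  -- e_j. For j > N, T_N e_j = e_j and the feedback vanishes.
  by_cases hjN : j ≤ N
  · have hκ := kerEig_weak hν hL hk j hφ
    rw [← hP', ← hP, ← hP, ← ha] at hκ
    simp only [if_pos hjN]
    linear_combination hκ
  · simp only [if_neg hjN, map_zero]
    ring

variable (L ν α γ μ k N T) in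
/-- The integrated form of the closed-loop problem along `primitiveH1`. -/
theorem isWeakSolution_primitiveH1 (hL : 0 < L) {τ : ℝ} {h₀ : L2 L} {h : ℝ → L2 L}
    (hc : Continuous h) (h0 : h 0 = h₀)
    (hw : ∀ φ : ℝ → ℂ, ContDiff ℝ ∞ φ → φ 0 = 0 → ∀ t ∈ Icc 0 τ,
      ∫ x in Ioo 0 L, volterra L (h t) x * φ x = (∫ x in Ioo 0 L, volterra L h₀ x * φ x) +
        ∫ s in (0 : ℝ)..t, (((ν : ℂ) + Complex.I * α) *
            (feedback L ν α μ k N T (proj L N (volterra L (h s))) * φ L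
              - ∫ x in Ioo 0 L, h s x * deriv φ x)
          + (γ : ℂ) * ∫ x in Ioo 0 L, volterra L (h s) x * φ x)) :
    IsWeakSolution L ν α γ μ k N T τ (primitiveH1 hL.le h₀) fun t => primitiveH1 hL.le (h t) where
  continuousOn := ((primitiveH1 hL.le).continuous.comp hc).continuousOn
  initial := by rw [h0]
  dirichlet := fun t _ => vanishesAtZero_primitiveH1 hL.le _
  weak := hw

/-- The derivative of the solution with initial datum `∫₀ˣ h₀`. -/
def solDeriv (hL : 0 < L) (hk : IsKernel L ν α μ k) (γ : ℝ) (N : ℕ) (T : L2 L ≃L[ℂ] L2 L)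
    (h₀ : L2 L) (t : ℝ) : L2 L :=
  derivTransform hL hk N (diagSemigroup (cosBasis hL) (targetRate L ν α γ μ N) t
    (derivTransformInv hL hk N T h₀))

theorem norm_solDeriv_le (hL : 0 < L) (hk : IsKernel L ν α μ k) {η : ℝ}
    (hη : ∀ n, (targetRate L ν α γ μ N n).re ≤ -η) (h₀ : L2 L) {t : ℝ} (ht : 0 ≤ t) :
    ‖solDeriv hL hk γ N T h₀ t‖
      ≤ ‖derivTransform hL hk N‖ * ‖derivTransformInv hL hk N T‖ * Real.exp (-η * t) * ‖h₀‖ := by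
  calc _ ≤ ‖derivTransform hL hk N‖ * (Real.exp (-η * t) *
        (‖derivTransformInv hL hk N T‖ * ‖h₀‖)) := by
        refine (ContinuousLinearMap.le_opNorm _ _).trans ?_
        gcongr
        refine (norm_diagSemigroup_le _ hη ht _).trans ?_
        gcongr
        exact ContinuousLinearMap.le_opNorm _ _
    _ = _ := by ring

theorem IsAdmissible.isWeakSolution (hL : 0 < L) (hν : 0 < ν) (hk : IsKernel L ν α μ k)
    (hT : IsAdmissible L k μ N T) (hσ : ∀ n, (targetRate L ν α γ μ N n).re ≤ 0) (h₀ : L2 L)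
    (τ : ℝ) : IsWeakSolution L ν α γ μ k N T τ (primitiveH1 hL.le h₀)
      fun t => primitiveH1 hL.le (solDeriv hL hk γ N T h₀ t) := by
  have hinv := hT.derivTransform_inv hL hk h₀
  refine isWeakSolution_primitiveH1 L ν α γ μ k N T hL
    ((derivTransform hL hk N).continuous.comp (continuous_diagSemigroup _ hσ _)) ?_ ?_
  · rw [solDeriv, diagSemigroup_zero, hinv]
  · intro φ hφ hφ0 t ht
    obtain ⟨A, B, hA, hB, hAB⟩ := hT.exists_functionals (γ := γ) hL hν hk (hφ.of_le (by simp)) hφ0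
    have h := diagSemigroup_evolution (cosBasis hL) hσ (A.comp (derivTransform hL hk N))
      (B.comp (derivTransform hL hk N)) hAB ht.1 (derivTransformInv hL hk N T h₀)
    simp only [ContinuousLinearMap.comp_apply, hinv] at h
    simp only [hA, hB] at h
    exact h

/-- The eigenfunction e_j is itself an admissible test function, so each mode of a weak solution
satisfies a scalar integral equation driven by the feedback. -/
theorem IsWeakSolution.inner_eq (hL : 0 < L) (hk : IsKernel L ν α μ k)
    (hT : IsAdmissible L k μ N T) {τ : ℝ} {u₀ : H1 L} {u : ℝ → H1 L}
    (hu : IsWeakSolution L ν α γ μ k N T τ u₀ u) (j : ℕ) {t : ℝ} (ht : t ∈ Icc 0 τ) :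
    inner ℂ (eigL2 L j) (fn (u t)) = inner ℂ (eigL2 L j) (fn u₀) + ∫ s in (0 : ℝ)..t,
      (((ν : ℂ) + Complex.I * α) * eigfun L j L * feedbackCLM k N T (fn (u s))
        + (γ - ((ν : ℂ) + Complex.I * α) * eigval L j) * inner ℂ (eigL2 L j) (fn (u s))) := by
  rw [inner_eigL2, inner_eigL2, hu.weak _ (contDiff_eigfun L j) (eigfun_zero L j) t ht]
  congr 1
  refine intervalIntegral.integral_congr fun s hs => ?_
  rw [uIcc_of_le ht.1] at hs
  have hus := eq_primitiveH1_of_vanishesAtZero hL (hu.dirichlet s ⟨hs.1, hs.2.trans ht.2⟩)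
  have hfn : fn (u s) = volterra L (dx (u s)) := congrArg fn hus
  have h1 : ∫ x in Ioo 0 L, dx (u s) x * deriv (eigfun L j) x
      = eigval L j * inner ℂ (eigL2 L j) (fn (u s)) := by
    have h2 : ∀ x, dx (u s) x * deriv (eigfun L j) x = freq L j * (dx (u s) x * cosfun L j x) :=
      fun x => by
        rw [(hasDerivAt_eigfun L j x).deriv]
        ring
    simp only [h2]
    rw [integral_const_mul, ← inner_cosL2, inner_cosL2_eq hL, ← hfn, ← freq_sq]
    push_cast
    ring
  simp only [h1, ← inner_eigL2, hT.feedback_eq hL hk]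
  ring

/-- Weak solutions of the closed-loop problem are unique. -/
theorem IsWeakSolution.unique (hL : 0 < L) (hk : IsKernel L ν α μ k)
    (hT : IsAdmissible L k μ N T) {τ : ℝ} {u₀ : H1 L} {u v : ℝ → H1 L}
    (hu : IsWeakSolution L ν α γ μ k N T τ u₀ u) (hv : IsWeakSolution L ν α γ μ k N T τ u₀ v)
    {t : ℝ} (ht : t ∈ Icc 0 τ) : v t = u t := by
  have hτ : 0 ≤ τ := ht.1.trans ht.2
  -- Constant extension outside [0, τ] makes the difference continuous on the whole line, so the
  -- integrals below are differentiable at every time.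
  set D : ℝ → L2 L := IccExtend hτ (fun s : Icc 0 τ => fn (v s) - fn (u s)) with hD
  have hDc : Continuous D := by
    refine Continuous.Icc_extend' ?_
    exact (continuous_fn.comp_continuousOn hv.continuousOn).domRestrict.sub
      (continuous_fn.comp_continuousOn hu.continuousOn).domRestrict
  have hDe : ∀ s ∈ Icc 0 τ, D s = fn (v s) - fn (u s) := fun s hs => by
    rw [hD, IccExtend_of_mem _ _ hs]
  set G : ℕ → L2 L →L[ℂ] ℂ := fun j =>
    (((ν : ℂ) + Complex.I * α) * eigfun L j L) • feedbackCLM k N T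
      + (γ - ((ν : ℂ) + Complex.I * α) * eigval L j) • innerSL ℂ (eigL2 L j) with hG
  have hGa : ∀ j w, G j w = ((ν : ℂ) + Complex.I * α) * eigfun L j L * feedbackCLM k N T w
      + (γ - ((ν : ℂ) + Complex.I * α) * eigval L j) * inner ℂ (eigL2 L j) w := fun j w => by
    simp [hG]
  have hGc : ∀ (j : ℕ) {w : ℝ → H1 L}, ContinuousOn w (Icc 0 τ) → ∀ r ∈ Icc 0 τ,
      IntervalIntegrable (fun s => G j (fn (w s))) volume 0 r := fun j w hw r hr =>
    intervalIntegrable_of_continuousOn_Icc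
      ((G j).continuous.comp_continuousOn (continuous_fn.comp_continuousOn hw)) hr
  have hvol : ∀ j, ∀ r ∈ Icc 0 τ, inner ℂ (eigL2 L j) (D r) = ∫ s in (0 : ℝ)..r, G j (D s) := by
    intro j r hr
    have h1 := hu.inner_eq hL hk hT j hr
    have h2 := hv.inner_eq hL hk hT j hr
    simp only [← hGa] at h1 h2
    rw [hDe r hr, inner_sub_right, h1, h2, add_sub_add_left_eq_sub,
      ← intervalIntegral.integral_sub (hGc j hv.continuousOn r hr) (hGc j hu.continuousOn r hr)]
    refine intervalIntegral.integral_congr fun s hs => ?_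
    rw [uIcc_of_le hr.1] at hs
    simp only [hDe s ⟨hs.1, hs.2.trans hr.2⟩, map_sub]
  -- On [0, τ] the first J modes of D satisfy Z' = M Z with M bounded and Z(0) = 0, because M
  -- depends only on these modes once J ≥ N. ODE uniqueness gives Z = 0.
  have hproj : ∀ J, N ≤ J → proj L J (D t) = 0 := by
    intro J hJ
    set Z : ℝ → L2 L := fun r => ∑ j ∈ Finset.Icc 1 J, (∫ s in (0 : ℝ)..r, G j (D s)) • eigL2 L j
      with hZ
    have hZp : ∀ r ∈ Icc 0 τ, Z r = proj L J (D r) := fun r hr => by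
      rw [proj_apply, hZ]
      exact Finset.sum_congr rfl fun j _ => by rw [hvol j r hr]
    set M : L2 L →L[ℂ] L2 L := ∑ j ∈ Finset.Icc 1 J, (G j).smulRight (eigL2 L j) with hM
    have hMa : ∀ w, M w = ∑ j ∈ Finset.Icc 1 J, G j w • eigL2 L j := fun w => by simp [hM]
    have hMp : ∀ w, M (proj L J w) = M w := fun w => by
      rw [hMa, hMa]
      refine Finset.sum_congr rfl fun j hj => ?_
      rw [hGa, hGa, hT.feedbackCLM_proj hL hk hJ, inner_proj hL hj]
    have hZd : ∀ r, HasDerivAt Z (M (D r)) r := fun r => by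
      rw [hMa]
      refine HasDerivAt.fun_sum fun j _ => HasDerivAt.smul_const ?_ _
      have hc : Continuous fun s => G j (D s) := (G j).continuous.comp hDc
      exact intervalIntegral.integral_hasDerivAt_right (hc.intervalIntegrable _ _)
        (hc.stronglyMeasurableAtFilter _ _) hc.continuousAt
    have h := ODE_solution_unique (v := fun _ w => M w) (f := Z) (g := fun _ => 0) (a := 0) (b := τ)
      (K := ‖M‖₊) (fun _ => M.lipschitz)
      (fun r _ => (hZd r).continuousAt.continuousWithinAt)
      (fun r hr => by
        rw [hZp r (Ico_subset_Icc_self hr), hMp]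
        exact (hZd r).hasDerivWithinAt)
      continuousOn_const
      (fun r _ => by
        rw [map_zero]
        exact (hasDerivAt_const r _).hasDerivWithinAt)
      (by simp [hZ])
    rw [← hZp t ht, h ht]
  have hv' := eq_primitiveH1_of_vanishesAtZero hL (hv.dirichlet t ht)
  have hu' := eq_primitiveH1_of_vanishesAtZero hL (hu.dirichlet t ht)
  have hDt : D t = volterra L (dx (v t) - dx (u t)) := by
    rw [hDe t ht, map_sub, ← fn_primitiveH1 hL.le, ← hv', ← fn_primitiveH1 hL.le, ← hu']
  have hdx : dx (v t) - dx (u t) = 0 := by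
    refine eq_zero_of_inner_eigL2_volterra hL fun j hj => ?_
    rw [← hDt, ← inner_proj hL (Finset.mem_Icc.2 ⟨hj, le_max_right N j⟩),
      hproj _ (le_max_left N j), inner_zero_right]
  rw [hv', hu', sub_eq_zero.1 hdx]

/-- Well-posedness and exponential decay for the closed-loop problem, given a spectral bound for
the target system. -/
theorem IsAdmissible.wellPosed_and_decays (hL : 0 < L) (hν : 0 < ν) (hk : IsKernel L ν α μ k)
    (hT : IsAdmissible L k μ N T) {η : ℝ} (hη0 : 0 < η)
    (hη : ∀ n, (targetRate L ν α γ μ N n).re ≤ -η) :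
    IsWellPosed L ν α γ μ k N T ∧ IsGloballyExpStable L ν α γ μ k N T ∧
      DecaysAtRate L ν α γ μ k N T η := by
  have hσ : ∀ n, (targetRate L ν α γ μ N n).re ≤ 0 := fun n => (hη n).trans (by linarith)
  have hsol : ∀ u₀ : H1 L, VanishesAtZero u₀ → ∀ τ, IsWeakSolution L ν α γ μ k N T τ u₀
      fun t => primitiveH1 hL.le (solDeriv hL hk γ N T (dx u₀) t) := fun u₀ hu₀ τ => by
    have h := hT.isWeakSolution hL hν hk hσ (dx u₀) τ
    rwa [← eq_primitiveH1_of_vanishesAtZero hL hu₀] at h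
  have hdecay : DecaysAtRate L ν α γ μ k N T η := by
    set C := ‖primitiveH1 hL.le‖ * (‖derivTransform hL hk N‖ * ‖derivTransformInv hL hk N T‖) with hC
    -- The constant is C + 1 to be positive even if C = 0. Any given solution is compared with the
    -- explicit one by uniqueness on [0, t + 1], an interval of positive length also when t = 0.
    refine ⟨C + 1, by positivity, fun u₀ u hu₀ hu t ht => ?_⟩
    have hut := (hsol u₀ hu₀ (t + 1)).unique hL hk hT (hu (t + 1) (by linarith))
      (t := t) ⟨ht, by linarith⟩
    rw [hut]
    calc _ ≤ ‖primitiveH1 hL.le‖ * (‖derivTransform hL hk N‖ * ‖derivTransformInv hL hk N T‖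
          * Real.exp (-η * t) * ‖u₀‖) := by
          refine (ContinuousLinearMap.le_opNorm _ _).trans ?_
          gcongr
          refine (norm_solDeriv_le hL hk hη _ ht).trans ?_
          gcongr
          exact norm_dx_le u₀
      _ = C * Real.exp (-η * t) * ‖u₀‖ := by rw [hC]; ring
      _ ≤ (C + 1) * Real.exp (-η * t) * ‖u₀‖ := by
          gcongr
          linarith
  refine ⟨fun u₀ hu₀ => ⟨_, fun τ _ => hsol u₀ hu₀ τ, fun τ v _ hv t ht => ?_⟩,
    ⟨η, hη0, hdecay⟩, hdecay⟩
  exact (hsol u₀ hu₀ τ).unique hL hk hT hv ht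

theorem eigval_eq (L : ℝ) (j : ℕ) : eigval L j = (2 * (j : ℝ) - 1) ^ 2 * eigval L 1 := by
  rw [eigval, eigval]
  push_cast
  ring

theorem eigval_one_pos (hL : 0 < L) : 0 < eigval L 1 := by
  rw [eigval]
  have := Real.pi_pos
  positivity

theorem eigval_mono (hL : 0 < L) {i j : ℕ} (hi : 1 ≤ i) (hij : i ≤ j) :
    eigval L i ≤ eigval L j := by
  rw [← freq_sq, ← freq_sq]
  have hij' : (i : ℝ) ≤ j := by exact_mod_cast hij
  have h := (freq_pos hL hi).le
  have hp := Real.pi_pos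
  unfold freq at h ⊢
  gcongr

theorem targetRate_re (L ν α γ μ : ℝ) (N n : ℕ) :
    (targetRate L ν α γ μ N n).re
      = γ - ν * eigval L (n + 1) - if n + 1 ≤ N then μ else 0 := by
  unfold targetRate
  split_ifs <;> simp

/-- The spectral bound of the target system is determined by the modes `1` and `N + 1`. -/
theorem targetRate_re_le (hL : 0 < L) (hν : 0 < ν) {η : ℝ}
    (h1 : η ≤ ν * eigval L 1 - γ + μ) (h2 : η ≤ ν * eigval L (N + 1) - γ) (n : ℕ) :
    (targetRate L ν α γ μ N n).re ≤ -η := by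
  rw [targetRate_re]
  split_ifs with h
  · have := mul_le_mul_of_nonneg_left (eigval_mono hL le_rfl (Nat.le_add_left 1 n)) hν.le
    linarith
  · have := mul_le_mul_of_nonneg_left
      (eigval_mono hL (Nat.le_add_left 1 N) (by omega : N + 1 ≤ n + 1)) hν.le
    linarith

end ClosedLoop

end CGL

end

/-! ### The two parameter regimes -/

theorem theorem1p3 (L ν α γ μ : ℝ) (hL : 0 < L) (hν : 0 < ν) (hγ : 0 ≤ γ)
    (k : ℝ → ℝ → ℂ) (hk : CGL.IsKernel L ν α μ k) :
    -- (i) rapid stabilization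
    (∀ (N : ℕ) (T : CGL.L2 L ≃L[ℂ] CGL.L2 L),
      μ > γ - ν * CGL.eigval L 1 →
      (N : ℝ) > max (μ / (4 * ν * CGL.eigval L 1) - 1 / 2)
        (μ / (2 * (μ + ν * CGL.eigval L 1 - γ)) - 1 / 2) →
      CGL.IsAdmissible L k μ N T →
        CGL.IsWellPosed L ν α γ μ k N T ∧
        CGL.IsGloballyExpStable L ν α γ μ k N T ∧
        CGL.DecaysAtRate L ν α γ μ k N T
          (ν * CGL.eigval L 1 - γ + μ * (1 - 1 / (2 * (N : ℝ) + 1)))) ∧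
    -- (ii) minimal number of Fourier modes
    (∀ (M : ℕ) (T : CGL.L2 L ≃L[ℂ] CGL.L2 L),
      CGL.eigval L M ≤ γ / ν → γ / ν < CGL.eigval L (M + 1) →
      2 * (γ - ν * CGL.eigval L 1) * (1 - 1 / (2 * (M : ℝ) + 1))⁻¹ < μ →
      μ < 2 * ν * CGL.eigval L (M + 1) →
      CGL.IsAdmissible L k μ M T →
        CGL.IsWellPosed L ν α γ μ k M T ∧
        CGL.IsGloballyExpStable L ν α γ μ k M T ∧
        CGL.DecaysAtRate L ν α γ μ k M T
          (ν * CGL.eigval L 1 - γ + μ / 2 * (1 - 1 / (2 * (M : ℝ) + 1) ^ 2))) := by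
  have hΛ : 0 < ν * CGL.eigval L 1 := mul_pos hν (CGL.eigval_one_pos hL)
  have heig : ∀ N : ℕ, ν * CGL.eigval L (N + 1) = (2 * (N : ℝ) + 1) ^ 2 * (ν * CGL.eigval L 1) :=
    fun N => by
      rw [CGL.eigval_eq L (N + 1)]
      push_cast
      ring
  have hinv : ∀ N : ℕ, 1 ≤ N → 3 ≤ 2 * (N : ℝ) + 1 ∧ 0 < 1 / (2 * (N : ℝ) + 1) ∧
      1 / (2 * (N : ℝ) + 1) < 1 := fun N hN => by
    have h1 : (1 : ℝ) ≤ N := by exact_mod_cast hN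
    refine ⟨by linarith, by positivity, ?_⟩
    rw [div_lt_one (by positivity)]
    linarith
  refine ⟨fun N T hμ hN hT => ?_, fun M T _ _ hlo hhi hT => ?_⟩
  · have hμ0 := hT.rate_pos
    obtain ⟨hn, hi0, hi1⟩ := hinv N hT.mode_pos
    obtain ⟨hN1, hN2⟩ := max_lt_iff.1 hN
    have hgap : 0 < μ + ν * CGL.eigval L 1 - γ := by linarith
    -- The first lower bound on N controls the uncontrolled mode N + 1; the second, used in `e2`,
    -- makes the rate positive.
    have e1 : μ < 2 * (ν * CGL.eigval L 1) * (2 * (N : ℝ) + 1) := by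
      rw [sub_lt_iff_lt_add, mul_assoc, div_lt_iff₀ (by positivity)] at hN1
      linarith
    have e2 : μ * (1 / (2 * (N : ℝ) + 1)) < μ + ν * CGL.eigval L 1 - γ := by
      rw [sub_lt_iff_lt_add, div_lt_iff₀ (by positivity)] at hN2
      rw [mul_one_div, div_lt_iff₀ (by positivity)]
      linarith
    have hη : 0 < ν * CGL.eigval L 1 - γ + μ * (1 - 1 / (2 * (N : ℝ) + 1)) := by linarith
    have h1 : ν * CGL.eigval L 1 - γ + μ * (1 - 1 / (2 * (N : ℝ) + 1))
        ≤ ν * CGL.eigval L 1 - γ + μ := by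
      linarith [mul_pos hμ0 hi0]
    -- By `e1`, μ (1 - 1/(2N+1)) ≤ 4N νλ_1, which is at most (4N² + 4N) νλ_1 = ν (λ_{N+1} - λ_1).
    have h2 : ν * CGL.eigval L 1 - γ + μ * (1 - 1 / (2 * (N : ℝ) + 1))
        ≤ ν * CGL.eigval L (N + 1) - γ := by
      rw [heig N]
      have h3 := mul_le_mul_of_nonneg_right e1.le (sub_nonneg.2 hi1.le)
      have h4 : 2 * (ν * CGL.eigval L 1) * (2 * (N : ℝ) + 1) * (1 - 1 / (2 * (N : ℝ) + 1))
          = 2 * (ν * CGL.eigval L 1) * (2 * N) := by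
        field_simp
        ring
      rw [h4] at h3
      nlinarith [mul_nonneg hΛ.le (sq_nonneg (N : ℝ))]
    exact hT.wellPosed_and_decays hL hν hk hη (CGL.targetRate_re_le hL hν h1 h2)
  · have hμ0 := hT.rate_pos
    obtain ⟨hn, hi0, hi1⟩ := hinv M hT.mode_pos
    rw [← div_eq_mul_inv, div_lt_iff₀ (sub_pos.2 hi1)] at hlo
    rw [mul_assoc, heig] at hhi
    have hsq : 1 / (2 * (M : ℝ) + 1) ^ 2 = (1 / (2 * (M : ℝ) + 1)) ^ 2 := by
      rw [div_pow, one_pow]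
    have hmul : (1 / (2 * (M : ℝ) + 1)) * (2 * (M : ℝ) + 1) = 1 := by
      field_simp
    rw [hsq]
    set i := 1 / (2 * (M : ℝ) + 1) with hi
    have hi2 : 0 ≤ 1 - i ^ 2 := by nlinarith
    -- The lower bound on μ says 2(γ - νλ_1) < μ(1 - i), and 1 - i ≤ (1 - i)(1 + i) = 1 - i².
    have hη : 0 < ν * CGL.eigval L 1 - γ + μ / 2 * (1 - i ^ 2) := by
      nlinarith [mul_pos (mul_pos hμ0 (sub_pos.2 hi1)) hi0]
    have h1 : ν * CGL.eigval L 1 - γ + μ / 2 * (1 - i ^ 2) ≤ ν * CGL.eigval L 1 - γ + μ := by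
      nlinarith [mul_nonneg hμ0.le (sq_nonneg i)]
    -- The bound μ/2 < νλ_{M+1} = (2M+1)² νλ_1, multiplied by 1 - i², leaves exactly ((2M+1)² - 1)
    -- νλ_1 = ν (λ_{M+1} - λ_1).
    have h2 : ν * CGL.eigval L 1 - γ + μ / 2 * (1 - i ^ 2) ≤ ν * CGL.eigval L (M + 1) - γ := by
      rw [heig M]
      have h3 := mul_le_mul_of_nonneg_right hhi.le hi2
      have h4 : (2 * (M : ℝ) + 1) ^ 2 * (1 - i ^ 2) = (2 * (M : ℝ) + 1) ^ 2 - 1 := by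
        linear_combination (-(i * (2 * (M : ℝ) + 1)) - 1) * hmul
      have h5 : 2 * ((2 * (M : ℝ) + 1) ^ 2 * (ν * CGL.eigval L 1)) * (1 - i ^ 2)
          = 2 * (ν * CGL.eigval L 1) * ((2 * (M : ℝ) + 1) ^ 2 - 1) := by
        rw [← h4]
        ring
      rw [h5] at h3
      linarith
    exact hT.wellPosed_and_decays hL hν hk hη (CGL.targetRate_re_le hL hν h1 h2)
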